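/- Conventions. Let $M$ be a smooth real $n$-manifold (Hausdorff, second countable) with a generalized complex structure $\mathcal J$: a smooth endomorphism of $TM\oplus T^*M$ with $\mathcal J^2=-1$, orthogonal for the pairing $(X+\xi,Y+\eta)=\xi(Y)+\eta(X)$, whose $\pm i$-eigenbundles $L_\pm\subset (TM\oplus T^*M)\otimes\mathbb C$ are closed under the Courant bracket $$[X+\xi,Y+\eta]=[X,Y]+\mathcal L_X\eta-\mathcal L_Y\xi-\tfrac12 d(\eta(X)-\xi(Y)).$$ Let $\rho$ be the projection to $T_{\mathbb C}M$. For a smooth function $f:U\to\mathbb C$, $d_\pm f$ is the map $L_\pm\to\mathbb C$, $u\mapsto\rho(u)f$; the pairing identifies $L_+^*$ with $L_-$, so that $d_+f$ is a section of $L_-$. The function $f$ is *generalized holomorphic* if $d_-f=0$; in this case $d_+f=df$. A generalized holomorphic section over $U$ of $G^*M:=L_-\cap T^*_{\mathbb C}M$ is a smooth complex one-form $\theta$ on $U$ with values in $L_-$ such that $\mathcal L_{\rho(l)}\theta=\iota_{\rho(l)}d\theta=0$ for all $l\in L_-$. A *generalized holomorphic vector bundle* is a smooth real vector bundle $\pi:E\to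 M$ together with a generalized complex structure on the total space $E$ and fibrewise real linear local trivializations $\varphi_i:\pi^{-1}(U_i)\to U_i\times\mathbb C^r$ over an open cover $\{U_i\}$ of $M$, which are diffeomorphisms such that $(\varphi_{i*},(\varphi_i^{-1})^*)$ intertwines the generalized complex structure of $E$ with the product of $\mathcal J$ and the standard complex structure of $\mathbb C^r$. The transition maps are then complex linear, so that $E$ is a complex vector bundle. Put $\varphi_{ij}=\varphi_i\circ\varphi_j^{-1}:U_i\cap U_j\to \mathrm{GL}(r,\mathbb C)$. A section of $E$ (of $G^*M\otimes E$, of $G^*M\otimes \mathrm{End}(E)$) is generalized holomorphic if, in each of the given trivializations, its components are generalized holomorphic functions (generalized holomorphic sections of $G^*M$). The sheaves of these sections are denoted by the same letters. A *generalized holomorphic connection* on $E$ is a $\mathbb C$-linear map of sheaves $D:E\to G^*M\otimes E$ with $D(fs)=d_+f\otimes s+fD(s)$ for all local generalized holomorphic functions $f$ and local generalized holomorphic sections $s$ of $E$. **Theorem.** The formula $$\alpha_{ij}=\varphi_j^{-1}\circ\bigl(\varphi_{ij}^{-1}\,d_+(\varphi_{ij})\bigr)\circ\varphi_j\qquad\text{on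 } U_i\cap U_j$$ defines a Čech one-cocycle of the cover $\{U_i\}$ with values in $G^*M\otimes\mathrm{End}(E)$. Let $A(E)$, the Atiyah class of $E$, be its class. Then $E$ admits a generalized holomorphic connection if and only if $A(E)=0$ in the Čech cohomology $\mathrm H^1(\{U_i\},G^*M\otimes\mathrm{End}(E))$ of this cover; equivalently, if and only if the image of $A(E)$ in $\mathrm H^1(M,G^*M\otimes\mathrm{End}(E))$, the direct limit of the Čech cohomology groups over all open covers of $M$, vanishes. -/

import Mathlib

open Bundle TopologicalSpace
open scoped Manifold ContDiff

noncomputable section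

namespace GenCplx

/-! ### Generalized complex structures -/

section Structures

variable {W : Type*} [NormedAddCommGroup W] [NormedSpace ℝ W]
  {H : Type*} [TopologicalSpace H] (I : ModelWithCorners ℝ W H)
  {M : Type*} [TopologicalSpace M] [ChartedSpace H M]

/-- The fibre of `TM ⊕ T^*M` at `x`. -/
abbrev GenTangent (x : M) : Type _ := TangentSpace I x × (TangentSpace I x →L[ℝ] ℝ)

/-- The fibre of `(TM ⊕ T^*M) ⊗ ℂ` at `x`; the pair `(a, b)` stands for `a + i b`. -/
abbrev GenTangentC (x : M) : Type _ := GenTangent I x × GenTangent I x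

variable {I}

/-- The pairing `(X + ξ, Y + η) = ξ(Y) + η(X)`. -/
def pairing {x : M} (a b : GenTangent I x) : ℝ := a.2 b.1 + b.2 a.1

/-- The complex bilinear extension of `pairing`. -/
def pairingC {x : M} (u v : GenTangentC I x) : ℂ :=
  ⟨pairing u.1 v.1 - pairing u.2 v.2, pairing u.1 v.2 + pairing u.2 v.1⟩

/-- The `+i`-eigenspace in `(TM ⊕ T^*M) ⊗ ℂ` of an endomorphism `J` of `TM ⊕ T^*M`:
`J a + i J b = i (a + i b)`. -/
def Lplus (J : ∀ x : M, GenTangent I x →L[ℝ] GenTangent I x) (x : M) : Set (GenTangentC I x) :=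
  {u | J x u.1 = -u.2 ∧ J x u.2 = u.1}

/-- The `-i`-eigenspace: `J a + i J b = -i (a + i b)`. -/
def Lminus (J : ∀ x : M, GenTangent I x →L[ℝ] GenTangent I x) (x : M) : Set (GenTangentC I x) :=
  {u | J x u.1 = u.2 ∧ J x u.2 = -u.1}

variable [IsManifold I ∞ M] {F : Type*} [NormedAddCommGroup F] [NormedSpace ℝ F]

/-- Smoothness on `U` of a one-form with values in the vector space `F`. -/
def SmoothFormOn (θ : ∀ x : M, TangentSpace I x →L[ℝ] F) (U : Set M) : Prop :=
  ContMDiffOn I (I.prod 𝓘(ℝ, W →L[ℝ] F)) ∞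
    (fun x => TotalSpace.mk' (W →L[ℝ] F)
      (E := fun x : M => TangentSpace I x →L[ℝ] Trivial M F x) x (θ x)) U

/-- Smoothness on `U` of a vector field. -/
def SmoothFieldOn (X : ∀ x : M, TangentSpace I x) (U : Set M) : Prop :=
  ContMDiffOn I I.tangent ∞ (fun x => (⟨x, X x⟩ : TangentBundle I M)) U

/-- Smoothness on `U` of a section of `TM ⊕ T^*M`. -/
def SmoothGenOn (a : ∀ x : M, GenTangent I x) (U : Set M) : Prop :=
  SmoothFieldOn (fun x => (a x).1) U ∧ SmoothFormOn (fun x => (a x).2) U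

/-- Smoothness on `U` of a section of `(TM ⊕ T^*M) ⊗ ℂ`. -/
def SmoothGenCOn (u : ∀ x : M, GenTangentC I x) (U : Set M) : Prop :=
  SmoothGenOn (fun x => (u x).1) U ∧ SmoothGenOn (fun x => (u x).2) U

/-- Smoothness of an endomorphism of the vector bundle `TM ⊕ T^*M`. -/
def SmoothEndo (J : ∀ x : M, GenTangent I x →L[ℝ] GenTangent I x) : Prop :=
  ContMDiff I (I.prod 𝓘(ℝ, (W × (W →L[ℝ] ℝ)) →L[ℝ] (W × (W →L[ℝ] ℝ)))) ∞
    (fun x => TotalSpace.mk' ((W × (W →L[ℝ] ℝ)) →L[ℝ] (W × (W →L[ℝ] ℝ)))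
      (E := fun x : M => (TangentSpace I x × (TangentSpace I x →L[ℝ] Trivial M ℝ x)) →L[ℝ]
        (TangentSpace I x × (TangentSpace I x →L[ℝ] Trivial M ℝ x))) x (J x))

/-- The one-form `θ` at points `x` near `x₀`, in the coordinates of the preferred chart at `x₀`. -/
def formInChart (θ : ∀ x : M, TangentSpace I x →L[ℝ] F) (x₀ x : M) : W →L[ℝ] F :=
  (θ x).comp ((trivializationAt W (TangentSpace I) x₀).symmL ℝ x)

/-- The derivative at `x` of the coordinate expression of `θ` in the preferred chart at `x`,
in which `T_x M` is `W`: `formDeriv θ x v w = ∂_v (θ(w))`. -/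
def formDeriv (θ : ∀ x : M, TangentSpace I x →L[ℝ] F) (x : M) : W →L[ℝ] W →L[ℝ] F :=
  mfderiv I 𝓘(ℝ, W →L[ℝ] F) (formInChart θ x) x

/-- The exterior derivative of a one-form: `dθ(v, w) = ∂_v (θ(w)) - ∂_w (θ(v))`. -/
def extD (θ : ∀ x : M, TangentSpace I x →L[ℝ] F) (x : M) :
    TangentSpace I x →L[ℝ] TangentSpace I x →L[ℝ] F :=
  formDeriv θ x - (formDeriv θ x).flip

/-- The differential of a function with values in a vector space, as a one-form. -/
def dFun (f : M → F) (x : M) : TangentSpace I x →L[ℝ] F := mfderiv I 𝓘(ℝ, F) f x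

/-- The Lie derivative of a one-form, `L_X η = ι_X dη + d(η(X))`. -/
def lieForm (X : ∀ x : M, TangentSpace I x) (η : ∀ x : M, TangentSpace I x →L[ℝ] ℝ) (x : M) :
    TangentSpace I x →L[ℝ] ℝ :=
  extD η x (X x) + dFun (fun y => η y (X y)) x

/-- The Courant bracket
`[X + ξ, Y + η] = [X, Y] + L_X η - L_Y ξ - ½ d(η(X) - ξ(Y))`. -/
def courant (a b : ∀ x : M, GenTangent I x) (x : M) : GenTangent I x :=
  (VectorField.mlieBracket I (fun y => (a y).1) (fun y => (b y).1) x,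
    lieForm (fun y => (a y).1) (fun y => (b y).2) x
      - lieForm (fun y => (b y).1) (fun y => (a y).2) x
      - (1 / 2 : ℝ) • dFun (fun y => (b y).2 (a y).1 - (a y).2 (b y).1) x)

/-- The complex bilinear extension of the Courant bracket. -/
def courantC (u v : ∀ x : M, GenTangentC I x) (x : M) : GenTangentC I x :=
  (courant (fun y => (u y).1) (fun y => (v y).1) x
      - courant (fun y => (u y).2) (fun y => (v y).2) x,
    courant (fun y => (u y).1) (fun y => (v y).2) x
      + courant (fun y => (u y).2) (fun y => (v y).1) x)

/-- A family `L` of subsets of the fibres of `(TM ⊕ T^*M) ⊗ ℂ` is closed under the Courant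
bracket of (local, smooth) sections. -/
def CourantClosed (L : ∀ x : M, Set (GenTangentC I x)) : Prop :=
  ∀ (U : Opens M) (u v : ∀ x : M, GenTangentC I x), SmoothGenCOn u U → SmoothGenCOn v U →
    (∀ x ∈ U, u x ∈ L x) → (∀ x ∈ U, v x ∈ L x) → ∀ x ∈ U, courantC u v x ∈ L x

variable (I M)

/-- A generalized complex structure on the manifold `M`. -/
structure GenComplexStructure where
  /-- the endomorphism of `TM ⊕ T^*M` -/
  J : ∀ x : M, GenTangent I x →L[ℝ] GenTangent I x
  smooth : SmoothEndo J
  sq : ∀ (x : M) (a : GenTangent I x), J x (J x a) = -a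
  orthogonal : ∀ (x : M) (a b : GenTangent I x), pairing (J x a) (J x b) = pairing a b
  integrable_plus : CourantClosed (Lplus J)
  integrable_minus : CourantClosed (Lminus J)

end Structures

/-! ### Generalized holomorphic homeomorphisms, products -/

section Homeo

variable {W : Type*} [NormedAddCommGroup W] [NormedSpace ℝ W]
  {H : Type*} [TopologicalSpace H] {I : ModelWithCorners ℝ W H}
  {M : Type*} [TopologicalSpace M] [ChartedSpace H M]
  {W' : Type*} [NormedAddCommGroup W'] [NormedSpace ℝ W']
  {H' : Type*} [TopologicalSpace H'] {I' : ModelWithCorners ℝ W' H'}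
  {M' : Type*} [TopologicalSpace M'] [ChartedSpace H' M']

/-- The map `(f_*, (f⁻¹)^*)` on `TM ⊕ T^*M` at a point `p` of the source of `f`. -/
def pushGen (f : OpenPartialHomeomorph M M') (p : M) (a : GenTangent I p) :
    GenTangent I' (f p) :=
  let A' : W' →L[ℝ] W := mfderiv I' I f.symm (f p)
  let ξ : W →L[ℝ] ℝ := a.2
  (mfderiv I I' f p a.1, ξ.comp A')

/-- `f` is a generalized holomorphic homeomorphism from its source to its target: it is a
diffeomorphism and `(f_*, (f⁻¹)^*) ∘ J = J' ∘ (f_*, (f⁻¹)^*)`. -/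
structure IsGenHolHomeo (J : ∀ x : M, GenTangent I x → GenTangent I x)
    (J' : ∀ x : M', GenTangent I' x → GenTangent I' x) (f : OpenPartialHomeomorph M M') :
    Prop where
  smooth : ContMDiffOn I I' ∞ f f.source
  smooth_symm : ContMDiffOn I' I ∞ f.symm f.target
  comm : ∀ p ∈ f.source, ∀ a : GenTangent I p,
    pushGen (I' := I') f p (J p a) = J' (f p) (pushGen f p a)

/-- The endomorphism of `T(M × F) ⊕ T^*(M × F)` which is the product of an endomorphism `J` of
`TM ⊕ T^*M` and of the endomorphism `(w, τ) ↦ (j w, - j^* τ)` of `TF ⊕ T^*F` given by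
the constant (almost) complex structure `j` on the vector space `F`. -/
def prodJ {F : Type*} [NormedAddCommGroup F] [NormedSpace ℝ F]
    (J : ∀ x : M, GenTangent I x → GenTangent I x) (j : F →L[ℝ] F) (q : M × F)
    (a : GenTangent (I.prod 𝓘(ℝ, F)) q) : GenTangent (I.prod 𝓘(ℝ, F)) q :=
  let X : W × F := a.1
  let ξ : W × F →L[ℝ] ℝ := a.2
  let b : W × (W →L[ℝ] ℝ) := J q.1 (X.1, ξ.comp (ContinuousLinearMap.inl ℝ W F))
  let τ : F →L[ℝ] ℝ := -((ξ.comp (ContinuousLinearMap.inr ℝ W F)).comp j)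
  (((b.1, j X.2) : W × F), (b.2.coprod τ : W × F →L[ℝ] ℝ))

theorem prodJ_vertical {F : Type*} [NormedAddCommGroup F] [NormedSpace ℝ F]
    (J : ∀ x : M, GenTangent I x →L[ℝ] GenTangent I x) (j : F →L[ℝ] F) (q : M × F)
    (a : GenTangent (I.prod 𝓘(ℝ, F)) q) (w : F) (h1 : a.1 = ((0, w) : W × F)) (h2 : a.2 = 0) :
    (prodJ (fun x => J x) j q a).1 = ((0, j w) : W × F) := by
  obtain ⟨X, ξ⟩ := a
  obtain rfl : X = ((0, w) : W × F) := h1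
  obtain rfl : ξ = 0 := h2
  have h : (J q.1 0).1 = 0 := congrArg Prod.fst (J q.1).map_zero
  exact Prod.ext h rfl

end Homeo

/-- The standard complex structure of `ℂ^r`. -/
def stdJ (r : ℕ) : (Fin r → ℂ) →L[ℝ] (Fin r → ℂ) :=
  (Complex.I • ContinuousLinearMap.id ℂ (Fin r → ℂ)).restrictScalars ℝ

/-! ### Generalized holomorphic functions and one-forms -/

section Functions

variable {W : Type*} [NormedAddCommGroup W] [NormedSpace ℝ W]
  {H : Type*} [TopologicalSpace H] {I : ModelWithCorners ℝ W H}
  {M : Type*} [TopologicalSpace M] [ChartedSpace H M]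

/-- The derivative `ρ(u) f` of a complex function `f`, where `ρ(u) = X + i Y` is the vector part
of `u`. -/
def anchorDeriv (f : M → ℂ) (x : M) (u : GenTangentC I x) : ℂ :=
  dFun f x u.1.1 + Complex.I * dFun f x u.2.1

/-- A complex-valued one-form at `x`, as an element of `(TM ⊕ T^*M) ⊗ ℂ`. -/
def covectorC {x : M} (θ : TangentSpace I x →L[ℝ] ℂ) : GenTangentC I x :=
  ((0, Complex.reCLM.comp θ), (0, Complex.imCLM.comp θ))

/-- The covector part of an element of `(TM ⊕ T^*M) ⊗ ℂ`. -/
def covectorPart {x : M} (u : GenTangentC I x) : TangentSpace I x →L[ℝ] ℂ :=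
  Complex.ofRealCLM.comp u.1.2 + Complex.I • Complex.ofRealCLM.comp u.2.2

variable [IsManifold I ∞ M] (𝒥 : GenComplexStructure I M)

/-- `f` is generalized holomorphic on `U`: it is smooth and its Lie algebroid differential
`d_- f : L_- → ℂ`, `u ↦ ρ(u) f`, vanishes. -/
def GenHolOn (f : M → ℂ) (U : Set M) : Prop :=
  ContMDiffOn I 𝓘(ℝ, ℂ) ∞ f U ∧ ∀ x ∈ U, ∀ u ∈ Lminus 𝒥.J x, anchorDeriv f x u = 0

/-- The differential `d_+ f`, a section of `L_+^* ≅ L_-`: the `L_-`-component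
`½ (df + i J df)` of `df`; see `dPlus_mem` and `dPlus_pairing`. -/
def dPlus (f : M → ℂ) (x : M) : GenTangentC I x :=
  let u : GenTangentC I x := covectorC (dFun f x)
  ((1 / 2 : ℝ) • (u.1 - 𝒥.J x u.2), (1 / 2 : ℝ) • (u.2 + 𝒥.J x u.1))

theorem dPlus_mem (f : M → ℂ) (x : M) : dPlus 𝒥 f x ∈ Lminus 𝒥.J x := by
  refine ⟨?_, ?_⟩
  · change 𝒥.J x ((1 / 2 : ℝ) • _) = (1 / 2 : ℝ) • _
    rw [(𝒥.J x).map_smul, (𝒥.J x).map_sub, 𝒥.sq, sub_neg_eq_add, add_comm]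
  · change 𝒥.J x ((1 / 2 : ℝ) • _) = -((1 / 2 : ℝ) • _)
    rw [(𝒥.J x).map_smul, (𝒥.J x).map_add, 𝒥.sq]
    refine Prod.ext ?_ ?_
    · simp only [Prod.smul_fst, Prod.fst_add, Prod.fst_neg, Prod.fst_sub]
      rw [← smul_neg, neg_sub, sub_eq_add_neg]
    · refine ContinuousLinearMap.ext fun w => ?_
      simp only [Prod.smul_snd, Prod.snd_add, Prod.snd_neg, Prod.snd_sub, neg_apply, smul_apply,
        add_apply, sub_apply, smul_eq_mul]
      ring

theorem dPlus_pairing (f : M → ℂ) (x : M) (u : GenTangentC I x) (hu : u ∈ Lplus 𝒥.J x) :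
    pairingC (dPlus 𝒥 f x) u = anchorDeriv f x u := by
  have key : ∀ a b : GenTangent I x, pairing (𝒥.J x a) b = -pairing a (𝒥.J x b) := by
    intro a b
    have h := 𝒥.orthogonal x a (𝒥.J x b)
    rw [𝒥.sq] at h
    rw [← h]
    simp only [pairing, Prod.fst_neg, Prod.snd_neg, map_neg, neg_apply]
    ring
  have h1 : ∀ a b c : GenTangent I x,
      pairing ((1 / 2 : ℝ) • (a - 𝒥.J x b)) c = (pairing a c + pairing b (𝒥.J x c)) / 2 := by
    intro a b c
    have := key b c
    simp only [pairing, Prod.smul_fst, Prod.smul_snd, Prod.fst_sub, Prod.snd_sub, map_sub,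
      map_smul, sub_apply, smul_apply, smul_eq_mul]
      at this ⊢
    linarith
  have h2 : ∀ a b c : GenTangent I x,
      pairing ((1 / 2 : ℝ) • (a + 𝒥.J x b)) c = (pairing a c - pairing b (𝒥.J x c)) / 2 := by
    intro a b c
    have := key b c
    simp only [pairing, Prod.smul_fst, Prod.smul_snd, Prod.fst_add, Prod.snd_add, map_add,
      map_smul, add_apply, smul_apply, smul_eq_mul]
      at this ⊢
    linarith
  obtain ⟨hu1, hu2⟩ := hu
  simp only [pairingC, dPlus, h1, h2, hu1, hu2]
  apply Complex.ext <;>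
    simp [anchorDeriv, covectorC, pairing] <;> ring

/-- `θ` is a generalized holomorphic section on `U` of `G^*M = L_- ∩ T^*M ⊗ ℂ`: it is a smooth
one-form with values in `L_-` which is annihilated by the `L_-`-connection
`l ↦ L_{ρ(l)} = [l, ·]`; as `θ` vanishes on `ρ(L_-)`, this means `ι_{ρ(l)} dθ = 0` for all
`l ∈ L_-`. -/
def GenHolFormOn (θ : ∀ x : M, TangentSpace I x →L[ℝ] ℂ) (U : Set M) : Prop :=
  SmoothFormOn θ U ∧ (∀ x ∈ U, covectorC (θ x) ∈ Lminus 𝒥.J x) ∧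
    ∀ x ∈ U, ∀ l ∈ Lminus 𝒥.J x, ∀ w : TangentSpace I x,
      extD θ x l.1.1 w + Complex.I * extD θ x l.2.1 w = 0

variable {𝒥}

theorem GenHolOn.mdiff {f : M → ℂ} {U : Opens M} (hf : GenHolOn 𝒥 f U) {x : M} (hx : x ∈ U) :
    MDifferentiableAt I 𝓘(ℝ, ℂ) f x :=
  ((hf.1 x hx).contMDiffAt (U.isOpen.mem_nhds hx)).mdifferentiableAt (by simp)

theorem GenHolOn.mono {f : M → ℂ} {U V : Set M} (hf : GenHolOn 𝒥 f U) (h : V ⊆ U) :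
    GenHolOn 𝒥 f V :=
  ⟨hf.1.mono h, fun x hx => hf.2 x (h hx)⟩

theorem GenHolOn.const (c : ℂ) (U : Set M) : GenHolOn 𝒥 (fun _ => c) U := by
  refine ⟨contMDiffOn_const, fun x _ u _ => ?_⟩
  have h : dFun (I := I) (fun _ : M => c) x = 0 := mfderiv_const
  simp [anchorDeriv, h]

theorem GenHolOn.add {f g : M → ℂ} {U : Opens M} (hf : GenHolOn 𝒥 f U) (hg : GenHolOn 𝒥 g U) :
    GenHolOn 𝒥 (fun x => f x + g x) U := by
  refine ⟨hf.1.add hg.1, fun x hx u hu => ?_⟩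
  have h : dFun (I := I) (fun x => f x + g x) x = dFun f x + dFun g x :=
    mfderiv_add (hf.mdiff hx) (hg.mdiff hx)
  have h1 := hf.2 x hx u hu
  have h2 := hg.2 x hx u hu
  simp only [anchorDeriv, h, add_apply] at h1 h2 ⊢
  linear_combination h1 + h2

theorem GenHolOn.mul {f g : M → ℂ} {U : Opens M} (hf : GenHolOn 𝒥 f U) (hg : GenHolOn 𝒥 g U) :
    GenHolOn 𝒥 (fun x => f x * g x) U := by
  refine ⟨((contDiff_mul (𝕜 := ℝ) (𝔸 := ℂ) (n := ∞)).contMDiff).comp_contMDiffOn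
    (hf.1.prodMk_space hg.1), fun x hx u hu => ?_⟩
  have h : ∀ v, dFun (I := I) (fun x => f x * g x) x v = f x * dFun g x v + g x * dFun f x v := by
    intro v
    have := ((hf.mdiff hx).hasMFDerivAt.mul (hg.mdiff hx).hasMFDerivAt).mfderiv
    exact DFunLike.congr_fun this v
  have h1 := hf.2 x hx u hu
  have h2 := hg.2 x hx u hu
  simp only [anchorDeriv, h] at h1 h2 ⊢
  linear_combination g x * h1 + f x * h2

section Forms

theorem GenHolFormOn.mono {θ : ∀ x : M, TangentSpace I x →L[ℝ] ℂ} {U V : Set M}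
    (hθ : GenHolFormOn 𝒥 θ U) (h : V ⊆ U) : GenHolFormOn 𝒥 θ V :=
  ⟨ContMDiffOn.mono hθ.1 h, fun x hx => hθ.2.1 x (h hx), fun x hx => hθ.2.2 x (h hx)⟩

theorem smoothFormOn_iff {F : Type*} [NormedAddCommGroup F] [NormedSpace ℝ F]
    {θ : ∀ x : M, TangentSpace I x →L[ℝ] F} {U : Opens M} :
    SmoothFormOn θ U ↔
      ∀ x ∈ U, ContMDiffAt I 𝓘(ℝ, W →L[ℝ] F) ∞ (formInChart θ x) x := by
  have key : ∀ x ∈ U, (ContMDiffWithinAt I (I.prod 𝓘(ℝ, W →L[ℝ] F)) ∞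
    (fun x => TotalSpace.mk' (W →L[ℝ] F)
      (E := fun x : M => TangentSpace I x →L[ℝ] Trivial M F x) x (θ x)) U x ↔
      ContMDiffAt I 𝓘(ℝ, W →L[ℝ] F) ∞ (formInChart θ x) x) := by
    intro x hx
    have hn := U.isOpen.mem_nhds hx
    refine Iff.trans ⟨fun h => h.contMDiffAt hn, fun h => h.contMDiffWithinAt⟩ ?_
    rw [contMDiffAt_hom_bundle]
    have : (fun y => ContinuousLinearMap.inCoordinates W (TangentSpace I) F (Trivial M F)
        x y x y (θ y)) = formInChart θ x := by
      funext y
      ext w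
      simp [ContinuousLinearMap.inCoordinates, formInChart]
    exact ⟨fun h => this ▸ h.2, fun h => ⟨contMDiffAt_id, this ▸ h⟩⟩
  exact ⟨fun h x hx => (key x hx).1 (h x hx), fun h x hx => (key x hx).2 (h x hx)⟩

theorem formInChart_lin {F : Type*} [NormedAddCommGroup F] [NormedSpace ℝ F]
    {θ η : ∀ x : M, TangentSpace I x →L[ℝ] F} (S T : F →L[ℝ] F) (x₀ : M) :
    formInChart (fun x => S.comp (θ x) + T.comp (η x)) x₀ = fun x =>
      S.comp (formInChart θ x₀ x) + T.comp (formInChart η x₀ x) := rfl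

theorem SmoothFormOn.lin {F : Type*} [NormedAddCommGroup F] [NormedSpace ℝ F]
    {θ η : ∀ x : M, TangentSpace I x →L[ℝ] F} (S T : F →L[ℝ] F) {U : Opens M}
    (hθ : SmoothFormOn θ U) (hη : SmoothFormOn η U) :
    SmoothFormOn (fun x => S.comp (θ x) + T.comp (η x)) U := by
  rw [smoothFormOn_iff] at hθ hη ⊢
  intro x hx
  rw [formInChart_lin]
  exact ((ContinuousLinearMap.contMDiff (ContinuousLinearMap.compL ℝ W F F S)).contMDiffAt.comp x
      (hθ x hx)).add
    ((ContinuousLinearMap.contMDiff (ContinuousLinearMap.compL ℝ W F F T)).contMDiffAt.comp x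
      (hη x hx))

theorem extD_lin {F : Type*} [NormedAddCommGroup F] [NormedSpace ℝ F]
    {θ η : ∀ x : M, TangentSpace I x →L[ℝ] F} (S T : F →L[ℝ] F) {U : Opens M}
    (hθ : SmoothFormOn θ U) (hη : SmoothFormOn η U) {x : M} (hx : x ∈ U)
    (v w : TangentSpace I x) :
    extD (fun x => S.comp (θ x) + T.comp (η x)) x v w = S (extD θ x v w) + T (extD η x v w) := by
  rw [smoothFormOn_iff] at hθ hη
  have h1 := ((hθ x hx).mdifferentiableAt (by simp)).hasMFDerivAt
  have h2 := ((hη x hx).mdifferentiableAt (by simp)).hasMFDerivAt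
  have h3 := ((ContinuousLinearMap.compL ℝ W F F S).hasMFDerivAt.comp x h1).add
    ((ContinuousLinearMap.compL ℝ W F F T).hasMFDerivAt.comp x h2)
  have h4 : formDeriv (fun x => S.comp (θ x) + T.comp (η x)) x =
      (ContinuousLinearMap.compL ℝ W F F S).comp (formDeriv θ x) +
        (ContinuousLinearMap.compL ℝ W F F T).comp (formDeriv η x) := h3.mfderiv
  have h5 : ∀ (κ : ∀ x : M, TangentSpace I x →L[ℝ] F), extD κ x v w =
    formDeriv κ x v w - formDeriv κ x w v := fun _ => rfl
  have h6 : ∀ v w : W, formDeriv (fun x => S.comp (θ x) + T.comp (η x)) x v w =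
      S (formDeriv θ x v w) + T (formDeriv η x v w) := by
    intro v w
    rw [h4]
    rfl
  rw [h5, h5, h5, map_sub, map_sub]
  refine (congrArg₂ (· - ·) (h6 v w) (h6 w v)).trans ?_
  abel

theorem covectorC_mem_iff (x : M) (θ : TangentSpace I x →L[ℝ] ℂ) :
    covectorC θ ∈ Lminus 𝒥.J x ↔ 𝒥.J x (0, Complex.reCLM.comp θ) = (0, Complex.imCLM.comp θ) := by
  refine ⟨fun h => h.1, fun h => ⟨h, ?_⟩⟩
  have := 𝒥.sq x (0, Complex.reCLM.comp θ)
  rw [h] at this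
  exact this

/-- Complex linear combinations of generalized holomorphic one-forms. -/
theorem GenHolFormOn.lin {θ η : ∀ x : M, TangentSpace I x →L[ℝ] ℂ} (c d : ℂ) {U : Opens M}
    (hθ : GenHolFormOn 𝒥 θ U) (hη : GenHolFormOn 𝒥 η U) :
    GenHolFormOn 𝒥 (fun x => c • θ x + d • η x) U := by
  let S : ℂ → ℂ →L[ℝ] ℂ := fun c => (c • ContinuousLinearMap.id ℂ ℂ).restrictScalars ℝ
  have hS : (fun x => c • θ x + d • η x) = fun x => (S c).comp (θ x) + (S d).comp (η x) := rfl
  refine ⟨?_, ?_, ?_⟩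
  · rw [hS]
    exact hθ.1.lin _ _ hη.1
  · intro x hx
    obtain ⟨h1, h2⟩ := hθ.2.1 x hx
    obtain ⟨h3, h4⟩ := hη.2.1 x hx
    have hre : ((0, Complex.reCLM.comp (c • θ x + d • η x)) : GenTangent I x) =
        (c.re • (covectorC (θ x)).1 - c.im • (covectorC (θ x)).2) +
        (d.re • (covectorC (η x)).1 - d.im • (covectorC (η x)).2) := by
      refine Prod.ext ?_ (ContinuousLinearMap.ext fun w => ?_)
      · simp [covectorC]
      · simp [covectorC]
    have him : ((0, Complex.imCLM.comp (c • θ x + d • η x)) : GenTangent I x) =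
        (c.re • (covectorC (θ x)).2 + c.im • (covectorC (θ x)).1) +
        (d.re • (covectorC (η x)).2 + d.im • (covectorC (η x)).1) := by
      refine Prod.ext ?_ (ContinuousLinearMap.ext fun w => ?_)
      · simp [covectorC]
      · simp [covectorC]
    rw [covectorC_mem_iff, hre, him, (𝒥.J x).map_add, (𝒥.J x).map_sub, (𝒥.J x).map_sub,
      (𝒥.J x).map_smul, (𝒥.J x).map_smul, (𝒥.J x).map_smul, (𝒥.J x).map_smul, h1, h2, h3, h4]
    refine Prod.ext ?_ (ContinuousLinearMap.ext fun w => ?_)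
    · simp
    · simp
  · intro x hx l hl w
    have h1 := hθ.2.2 x hx l hl w
    have h2 := hη.2.2 x hx l hl w
    rw [hS, extD_lin _ _ hθ.1 hη.1 hx, extD_lin _ _ hθ.1 hη.1 hx]
    simp only [S, ContinuousLinearMap.coe_restrictScalars', smul_apply,
      ContinuousLinearMap.id_apply, smul_eq_mul]
    linear_combination c * h1 + d * h2

theorem GenHolFormOn.zero (U : Opens M) :
    GenHolFormOn 𝒥 (fun x => (0 : TangentSpace I x →L[ℝ] ℂ)) U := by
  refine ⟨?_, fun x _ => ?_, fun x _ l _ w => ?_⟩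
  · rw [smoothFormOn_iff]
    intro x _
    exact contMDiffAt_const (c := (0 : W →L[ℝ] ℂ))
  · rw [covectorC_mem_iff]
    exact (𝒥.J x).map_zero
  · have h : extD (I := I) (fun x => (0 : TangentSpace I x →L[ℝ] ℂ)) x = 0 := by
      have h0 : formDeriv (I := I) (fun x => (0 : TangentSpace I x →L[ℝ] ℂ)) x = 0 :=
        mfderiv_const (c := (0 : W →L[ℝ] ℂ))
      unfold extD
      rw [h0]
      exact sub_self _
    simp [h]

end Forms

end Functions


/-! ### Čech cohomology in degree one -/

section Presheaf

open CategoryTheory Opposite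

variable {M : Type*} [TopologicalSpace M]

/-- The presheaf of families of elements of `A x` that satisfy a condition `P` stable under
restriction. -/
def presheafOf (A : M → Type*) [∀ x, AddCommGroup (A x)] [∀ x, Module ℂ (A x)]
    (P : ∀ U : Opens M, Submodule ℂ ((x : U) → A x))
    (hP : ∀ (U U' : Opens M) (h : U' ≤ U), ∀ s ∈ P U,
      (fun x : U' => s ⟨x.1, h x.2⟩) ∈ P U') : (Opens M)ᵒᵖ ⥤ ModuleCat ℂ where
  obj U := ModuleCat.of ℂ (P U.unop)
  map f := ModuleCat.ofHom
    { toFun := fun s => ⟨fun x => s.1 ⟨x.1, leOfHom f.unop x.2⟩, hP _ _ (leOfHom f.unop) s.1 s.2⟩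
      map_add' := fun _ _ => rfl
      map_smul' := fun _ _ => rfl }
  map_id _ := rfl
  map_comp _ _ := rfl

namespace Cech

/-- Restriction of sections. -/
def res (F : (Opens M)ᵒᵖ ⥤ ModuleCat ℂ) {U U' : Opens M} (h : U' ≤ U) :
    F.obj (op U) →ₗ[ℂ] F.obj (op U') :=
  (F.map (homOfLE h).op).hom

variable {ι κ : Type*} (U : ι → Opens M) (F : (Opens M)ᵒᵖ ⥤ ModuleCat ℂ)

/-- The differential `C^0 → C^1`, `(dβ)_ij = β_j - β_i`. -/
def d0 : ((i : ι) → F.obj (op (U i))) →ₗ[ℂ] ((i j : ι) → F.obj (op (U i ⊓ U j))) where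
  toFun β i j := res F inf_le_right (β j) - res F inf_le_left (β i)
  map_add' β γ := by
    funext i j
    simp only [Pi.add_apply, map_add]
    abel
  map_smul' a β := by
    funext i j
    simp only [Pi.smul_apply, map_smul, RingHom.id_apply, smul_sub]

/-- The differential `C^1 → C^2`, `(dα)_ijk = α_jk - α_ik + α_ij`. -/
def d1 : ((i j : ι) → F.obj (op (U i ⊓ U j))) →ₗ[ℂ]
    ((i j k : ι) → F.obj (op (U i ⊓ U j ⊓ U k))) where
  toFun α i j k :=
    res F (inf_le_inf_right (U k) inf_le_right) (α j k)
      - res F (inf_le_inf_right (U k) inf_le_left) (α i k) + res F inf_le_left (α i j)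
  map_add' β γ := by
    funext i j k
    simp only [Pi.add_apply, map_add]
    abel
  map_smul' a β := by
    funext i j k
    simp only [Pi.smul_apply, map_smul, RingHom.id_apply, smul_sub, smul_add]

/-- Čech one-cocycles of the cover `U`. -/
abbrev Z1 : Submodule ℂ ((i j : ι) → F.obj (op (U i ⊓ U j))) := LinearMap.ker (d1 U F)

/-- Čech one-coboundaries of the cover `U`, inside the one-cocycles. -/
abbrev B1 : Submodule ℂ (Z1 U F) := (LinearMap.range (d0 U F)).comap (Z1 U F).subtype

/-- The Čech cohomology `H^1(U, F)` of the cover `U`. -/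
abbrev H1 : Type _ := Z1 U F ⧸ B1 U F

variable {U F}

theorem res_res {U₁ U₂ U₃ : Opens M} (h : U₂ ≤ U₁) (h' : U₃ ≤ U₂) (s : F.obj (op U₁)) :
    res F h' (res F h s) = res F (h'.trans h) s := by
  have : (homOfLE (h'.trans h)).op = (homOfLE h).op ≫ (homOfLE h').op := rfl
  simp only [res, this, F.map_comp, ModuleCat.hom_comp, LinearMap.comp_apply]

/-- The map on one-cochains induced by a refinement `τ` of covers. -/
def refineC1 {U' : κ → Opens M} (τ : κ → ι) (h : ∀ k, U' k ≤ U (τ k)) :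
    ((i j : ι) → F.obj (op (U i ⊓ U j))) →ₗ[ℂ] ((k l : κ) → F.obj (op (U' k ⊓ U' l))) where
  toFun α k l := res F (inf_le_inf (h k) (h l)) (α (τ k) (τ l))
  map_add' β γ := by
    funext i j
    simp only [Pi.add_apply, map_add]
  map_smul' a β := by
    funext i j
    simp only [Pi.smul_apply, map_smul, RingHom.id_apply]

/-- The map on one-cocycles induced by a refinement of covers. -/
def refineZ1 {U' : κ → Opens M} (τ : κ → ι) (h : ∀ k, U' k ≤ U (τ k)) :
    Z1 U F →ₗ[ℂ] Z1 U' F :=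
  (refineC1 τ h).restrict (by
    intro α hα
    rw [LinearMap.mem_ker] at hα ⊢
    funext i j k
    have h1 := congrFun (congrFun (congrFun hα (τ i)) (τ j)) (τ k)
    have h2 := congrArg (res F (inf_le_inf (inf_le_inf (h i) (h j)) (h k))) h1
    simpa only [d1, refineC1, LinearMap.coe_mk, AddHom.coe_mk, map_add, map_sub, res_res,
      Pi.zero_apply, map_zero] using h2)

/-- The map on `H^1` induced by a refinement of covers. -/
def refineH1 {U' : κ → Opens M} (τ : κ → ι) (h : ∀ k, U' k ≤ U (τ k)) : H1 U F →ₗ[ℂ] H1 U' F :=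
  Submodule.mapQ _ _ (refineZ1 τ h) (by
    rintro ⟨α, hα⟩ ⟨β, hβ⟩
    refine ⟨fun k => res F (h k) (β (τ k)), ?_⟩
    change d0 U F β = α at hβ
    subst hβ
    funext i j
    change res F _ _ - res F _ _ = res F _ (res F _ _ - res F _ _)
    simp only [map_sub, res_res])

variable (M)

/-- Open covers of `M` indexed by the points of `M`, with `x ∈ U_x`; every open cover is refined
by one of these. `𝒰 ≤ 𝒱` means that `𝒱_x ⊆ 𝒰_x` for all `x`. -/
structure PointCover where
  /-- the open sets -/
  set : M → Opens M
  mem : ∀ x, x ∈ set x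

instance : Preorder (PointCover M) where
  le 𝒰 𝒱 := ∀ x, 𝒱.set x ≤ 𝒰.set x
  le_refl _ _ := le_rfl
  le_trans _ _ _ h h' x := (h' x).trans (h x)

variable {M}

open Classical in
/-- The Čech cohomology `H^1(M, F)`: the direct limit of `H^1(𝒰, F)` over all open covers. -/
abbrev H1Lim (F : (Opens M)ᵒᵖ ⥤ ModuleCat ℂ) : Type _ :=
  Module.DirectLimit (R := ℂ) (fun 𝒰 : PointCover M => H1 𝒰.set F)
    (fun _ _ h => refineH1 id h)

open Classical in
/-- The canonical map `H^1(U, F) → H^1(M, F)` for an open cover `U` of `M`. -/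
def toH1Lim (U : ι → Opens M) (hU : ∀ x, ∃ i, x ∈ U i) (F : (Opens M)ᵒᵖ ⥤ ModuleCat ℂ) :
    H1 U F →ₗ[ℂ] H1Lim F :=
  (Module.DirectLimit.of ℂ (PointCover M) (fun 𝒰 => H1 𝒰.set F) (fun _ _ h => refineH1 id h)
    ⟨fun x => U (hU x).choose, fun x => (hU x).choose_spec⟩).comp
    (refineH1 (fun x => (hU x).choose) (fun _ => le_rfl))

end Cech

end Presheaf

/-! ### Generalized holomorphic vector bundles -/

section VB

open CategoryTheory Opposite

variable {W : Type} [NormedAddCommGroup W] [NormedSpace ℝ W]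
  {H : Type*} [TopologicalSpace H] {I : ModelWithCorners ℝ W H}
  {M : Type*} [TopologicalSpace M] [ChartedSpace H M] [IsManifold I ∞ M]

/-- A generalized holomorphic vector bundle structure on a smooth real vector bundle `V` (of real
rank `2r`): a generalized complex structure on the total space, and local trivializations
`V|_{U_i} → U_i × ℂ^r` over an open cover which are generalized holomorphic homeomorphisms. -/
structure GenHolBundle (𝒥 : GenComplexStructure I M) (r : ℕ) (V : M → Type*)
    [∀ x, AddCommGroup (V x)] [∀ x, Module ℝ (V x)] [∀ x, TopologicalSpace (V x)]
    [TopologicalSpace (TotalSpace (Fin r → ℂ) V)] [FiberBundle (Fin r → ℂ) V]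
    [VectorBundle ℝ (Fin r → ℂ) V] [ContMDiffVectorBundle ∞ (Fin r → ℂ) V I] (ι : Type*) where
  /-- the generalized complex structure on the total space -/
  total : GenComplexStructure (I.prod 𝓘(ℝ, Fin r → ℂ)) (TotalSpace (Fin r → ℂ) V)
  /-- the local trivializations -/
  triv : ι → Trivialization (Fin r → ℂ) (π (Fin r → ℂ) V)
  linear : ∀ i, (triv i).IsLinear ℝ
  covers : ∀ x : M, ∃ i, x ∈ (triv i).baseSet
  genHol : ∀ i, IsGenHolHomeo (fun p => total.J p) (prodJ (fun x => 𝒥.J x) (stdJ r))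
    (triv i).toOpenPartialHomeomorph

namespace GenHolBundle

variable {𝒥 : GenComplexStructure I M} {r : ℕ} {V : M → Type*}
  [∀ x, AddCommGroup (V x)] [∀ x, Module ℝ (V x)] [∀ x, TopologicalSpace (V x)]
  [TopologicalSpace (TotalSpace (Fin r → ℂ) V)] [FiberBundle (Fin r → ℂ) V]
  [VectorBundle ℝ (Fin r → ℂ) V] [ContMDiffVectorBundle ∞ (Fin r → ℂ) V I] {ι : Type*}
  (E : GenHolBundle 𝒥 r V ι)

/-- The open cover `U_i`. -/
def cover (i : ι) : Opens M := ⟨(E.triv i).baseSet, (E.triv i).open_baseSet⟩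

/-- The real linear isomorphism `V_x → ℂ^r` given by the `i`-th trivialization. -/
def realEquiv (i : ι) (x : M) (hx : x ∈ E.cover i) : V x ≃ₗ[ℝ] (Fin r → ℂ) :=
  haveI := E.linear i
  (E.triv i).linearEquivAt ℝ x hx

/-- The transition maps are complex linear. -/
theorem transition_I_smul (i j : ι) (x : M) (hi : x ∈ E.cover i) (hj : x ∈ E.cover j)
    (w : Fin r → ℂ) :
    E.realEquiv j x hj ((E.realEquiv i x hi).symm (Complex.I • w)) =
      Complex.I • E.realEquiv j x hj ((E.realEquiv i x hi).symm w) := by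
  have hli := E.linear i
  have hlj := E.linear j
  let N : Type := Fin r → ℂ
  -- the inclusion of the fibre, through the `i`-th trivialization
  let c : N → TotalSpace (Fin r → ℂ) V :=
    fun v => (E.triv i).toOpenPartialHomeomorph.symm (x, v)
  have hc : ∀ v, c v = ⟨x, (E.realEquiv i x hi).symm v⟩ := fun v =>
    ((E.triv i).mk_symm hi v).symm
  let g : N →L[ℝ] N := LinearMap.toContinuousLinearMap
    (((E.realEquiv i x hi).symm.trans (E.realEquiv j x hj)).toLinearMap)
  have hei : ∀ v, E.triv i (c v) = (x, v) := fun v =>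
    (E.triv i).apply_symm_apply' hi
  have hej : ∀ v, E.triv j (c v) = (x, g v) := by
    intro v
    rw [hc]
    exact Prod.ext ((E.triv j).coe_fst' hj) rfl
  have hsi : c 0 ∈ (E.triv i).source := by
    rw [hc]; exact (E.triv i).mem_source.2 hi
  have hsj : c 0 ∈ (E.triv j).source := by
    rw [hc]; exact (E.triv j).mem_source.2 hj
  have hmi : OpenPartialHomeomorph.MDifferentiable (I.prod 𝓘(ℝ, N)) (I.prod 𝓘(ℝ, N))
      (E.triv i).toOpenPartialHomeomorph :=
    ⟨(E.genHol i).smooth.mdifferentiableOn (by simp),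
      (E.genHol i).smooth_symm.mdifferentiableOn (by simp)⟩
  have hmj : OpenPartialHomeomorph.MDifferentiable (I.prod 𝓘(ℝ, N)) (I.prod 𝓘(ℝ, N))
      (E.triv j).toOpenPartialHomeomorph :=
    ⟨(E.genHol j).smooth.mdifferentiableOn (by simp),
      (E.genHol j).smooth_symm.mdifferentiableOn (by simp)⟩
  have hincl : ∀ (h : N →L[ℝ] N), HasMFDerivAt 𝓘(ℝ, N) (I.prod 𝓘(ℝ, N))
      (fun v => (x, h v)) 0
      ((0 : TangentSpace 𝓘(ℝ, N) (0 : N) →L[ℝ] TangentSpace I x).prod h) := fun h =>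
    (hasMFDerivAt_const x (0 : N)).prodMk h.hasMFDerivAt
  have hmem : ((x, (0 : N)) : M × N) ∈ (E.triv i).target := (E.triv i).mem_target.2 hi
  have hdc : MDifferentiableAt 𝓘(ℝ, N) (I.prod 𝓘(ℝ, N)) c 0 :=
    (hmi.mdifferentiableAt_symm hmem).comp (0 : N)
      (hincl (ContinuousLinearMap.id ℝ N)).mdifferentiableAt
  have hAi : ∀ v : N, (mfderiv (I.prod 𝓘(ℝ, N)) (I.prod 𝓘(ℝ, N))
      (E.triv i).toOpenPartialHomeomorph (c 0)
      (mfderiv 𝓘(ℝ, N) (I.prod 𝓘(ℝ, N)) c 0 v) : W × N) = (0, v) := by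
    have h1 := (hmi.mdifferentiableAt hsi).hasMFDerivAt.comp (0 : N) hdc.hasMFDerivAt
    have h2 : (E.triv i).toOpenPartialHomeomorph ∘ c = 
        fun v => (x, (ContinuousLinearMap.id ℝ N) v) := funext hei
    rw [h2] at h1
    intro v
    exact DFunLike.congr_fun (hasMFDerivAt_unique h1 (hincl (ContinuousLinearMap.id ℝ N))) v
  have hAj : ∀ v : N, (mfderiv (I.prod 𝓘(ℝ, N)) (I.prod 𝓘(ℝ, N))
      (E.triv j).toOpenPartialHomeomorph (c 0)
      (mfderiv 𝓘(ℝ, N) (I.prod 𝓘(ℝ, N)) c 0 v) : W × N) = (0, g v) := by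
    have h1 := (hmj.mdifferentiableAt hsj).hasMFDerivAt.comp (0 : N) hdc.hasMFDerivAt
    have h2 : (E.triv j).toOpenPartialHomeomorph ∘ c = fun v => (x, g v) := funext hej
    rw [h2] at h1
    intro v
    exact DFunLike.congr_fun (hasMFDerivAt_unique h1 (hincl g)) v
  -- `J` applied to the vertical vector `w`
  let a : GenTangent (I.prod 𝓘(ℝ, N)) (c 0) := (mfderiv 𝓘(ℝ, N) (I.prod 𝓘(ℝ, N)) c 0 w, 0)
  have hi' : (mfderiv (I.prod 𝓘(ℝ, N)) (I.prod 𝓘(ℝ, N))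
      (E.triv i).toOpenPartialHomeomorph (c 0) (E.total.J (c 0) a).1 : W × N) =
      (0, Complex.I • w) := by
    refine (congrArg Prod.fst ((E.genHol i).comm (c 0) hsi a)).trans ?_
    exact prodJ_vertical 𝒥.J (stdJ r) _ _ w (hAi w) (ContinuousLinearMap.zero_comp _)
  have hj' : (mfderiv (I.prod 𝓘(ℝ, N)) (I.prod 𝓘(ℝ, N))
      (E.triv j).toOpenPartialHomeomorph (c 0) (E.total.J (c 0) a).1 : W × N) =
      (0, Complex.I • g w) := by
    refine (congrArg Prod.fst ((E.genHol j).comm (c 0) hsj a)).trans ?_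
    exact prodJ_vertical 𝒥.J (stdJ r) _ _ (g w) (hAj w) (ContinuousLinearMap.zero_comp _)
  have hb : (E.total.J (c 0) a).1 =
      mfderiv 𝓘(ℝ, N) (I.prod 𝓘(ℝ, N)) c 0 (Complex.I • w : N) :=
    hmi.mfderiv_injective hsi (hi'.trans (hAi (Complex.I • w : N)).symm)
  rw [hb] at hj'
  exact congrArg Prod.snd ((hAj (Complex.I • w : N)).symm.trans hj')

/-- The underlying vector space of the fibre of `E` at `x`, with the complex structure
transported from `ℂ^r` by a local trivialization; by `transition_I_smul`, all trivializations give
the same structure, see `fiberEquiv`. -/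
def Fiber (_ : GenHolBundle 𝒥 r V ι) (x : M) : Type _ := V x

instance (x : M) : AddCommGroup (E.Fiber x) := inferInstanceAs (AddCommGroup (V x))

/-- A trivialization around `x`. -/
def index (x : M) : ι := (E.covers x).choose

theorem mem_index (x : M) : x ∈ E.cover (E.index x) := (E.covers x).choose_spec

instance (x : M) : Module ℂ (E.Fiber x) :=
  AddEquiv.module ℂ (α := E.Fiber x)
    (E.realEquiv (E.index x) x (E.mem_index x)).toAddEquiv

/-- The complex linear isomorphism `E_x → ℂ^r` given by the `i`-th trivialization. -/
def fiberEquiv (i : ι) (x : M) (hx : x ∈ E.cover i) : E.Fiber x ≃ₗ[ℂ] (Fin r → ℂ) :=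
  { (E.realEquiv i x hx).toAddEquiv with
    map_smul' := by
      intro c (v : V x)
      let e := E.realEquiv (E.index x) x (E.mem_index x)
      let e' := E.realEquiv i x hx
      change e' (e.symm (c • e v)) = c • e' v
      have h : c • e v = c.re • e v + c.im • (Complex.I • e v) := by
        rw [← Complex.coe_smul, ← Complex.coe_smul, smul_smul, ← add_smul, Complex.re_add_im]
      have h' : c • e' v = c.re • e' v + c.im • (Complex.I • e' v) := by
        rw [← Complex.coe_smul, ← Complex.coe_smul, smul_smul, ← add_smul, Complex.re_add_im]
      have h'' : e' (e.symm (Complex.I • e v)) = Complex.I • e' v :=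
        (E.transition_I_smul _ _ x (E.mem_index x) hx (e v)).trans
          (congrArg (fun z => Complex.I • e' z) (e.symm_apply_apply v))
      rw [h, map_add, map_smul, map_smul, map_add, map_smul, map_smul, h'', h']
      exact congrArg (fun z => c.re • e' z + c.im • Complex.I • e' v) (e.symm_apply_apply v) }

/-! #### The sheaf of generalized holomorphic sections of `E` -/

/-- The generalized holomorphic sections of `E` over `U`: in each trivialization, the components
are generalized holomorphic functions. -/
def holSections (U : Opens M) : Submodule ℂ ((x : U) → E.Fiber x) where
  carrier := {s | ∀ i, ∃ f : Fin r → M → ℂ, (∀ l, GenHolOn 𝒥 (f l) (U ⊓ E.cover i : Opens M)) ∧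
    ∀ (x : U) (hi : x.1 ∈ E.cover i) (l : Fin r), E.fiberEquiv i x hi (s x) l = f l x}
  zero_mem' := fun i => ⟨fun _ _ => 0, fun _ => GenHolOn.const 0 _, fun x hi l => by simp⟩
  add_mem' := by
    intro s t hs ht i
    obtain ⟨f, hf, hf'⟩ := hs i
    obtain ⟨g, hg, hg'⟩ := ht i
    exact ⟨fun l x => f l x + g l x, fun l => (hf l).add (hg l), fun x hi l => by
      simp [hf' x hi l, hg' x hi l]⟩
  smul_mem' := by
    intro c s hs i
    obtain ⟨f, hf, hf'⟩ := hs i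
    exact ⟨fun l x => c * f l x, fun l => (GenHolOn.const c _).mul (hf l), fun x hi l => by
      simp [hf' x hi l]⟩

/-- The section `f s`. -/
def mulSection {U : Opens M} {f : M → ℂ} (hf : GenHolOn 𝒥 f U) (s : E.holSections U) :
    E.holSections U :=
  ⟨fun x => f x • s.1 x, by
    intro i
    obtain ⟨g, hg, hg'⟩ := s.2 i
    exact ⟨fun l x => f x * g l x,
      fun l => GenHolOn.mul (U := U ⊓ E.cover i) (hf.mono inf_le_left) (hg l), fun x hi l => by
      simp [hg' x hi l]⟩⟩

/-! #### The sheaf of generalized holomorphic sections of `G^*M ⊗ E` -/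

/-- The generalized holomorphic sections of `G^*M ⊗ E` over `U`, as one-forms with values in `E`:
in each trivialization, the components are generalized holomorphic sections of `G^*M`. -/
def holForms (U : Opens M) : Submodule ℂ ((x : U) → TangentSpace I x.1 →ₗ[ℝ] E.Fiber x) where
  carrier := {t | ∀ i, ∃ θ : Fin r → ∀ x : M, TangentSpace I x →L[ℝ] ℂ,
    (∀ l, GenHolFormOn 𝒥 (θ l) (U ⊓ E.cover i : Opens M)) ∧
    ∀ (x : U) (hi : x.1 ∈ E.cover i) (X : TangentSpace I x.1) (l : Fin r),
      E.fiberEquiv i x hi (t x X) l = θ l x X}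
  zero_mem' := fun i => ⟨fun _ _ => 0, fun _ => GenHolFormOn.zero _, fun x hi X l => by simp⟩
  add_mem' := by
    intro s t hs ht i
    obtain ⟨f, hf, hf'⟩ := hs i
    obtain ⟨g, hg, hg'⟩ := ht i
    exact ⟨fun l x => (1 : ℂ) • f l x + (1 : ℂ) • g l x, fun l => (hf l).lin 1 1 (hg l),
      fun x hi X l => by simp [hf' x hi X l, hg' x hi X l]⟩
  smul_mem' := by
    intro c s hs i
    obtain ⟨f, hf, hf'⟩ := hs i
    exact ⟨fun l x => c • f l x + (0 : ℂ) • f l x, fun l => (hf l).lin c 0 (hf l),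
      fun x hi X l => by simp [hf' x hi X l]⟩

/-! #### The sheaf of generalized holomorphic sections of `G^*M ⊗ End(E)` -/

/-- The generalized holomorphic sections of `G^*M ⊗ End(E)` over `U`, as one-forms with values in
`End(E)`: in each trivialization, they are matrices of generalized holomorphic sections of
`G^*M`. -/
def holEndForms (U : Opens M) :
    Submodule ℂ ((x : U) → TangentSpace I x.1 →ₗ[ℝ] Module.End ℂ (E.Fiber x)) where
  carrier := {t | ∀ i, ∃ A : Fin r → Fin r → ∀ x : M, TangentSpace I x →L[ℝ] ℂ,
    (∀ l m, GenHolFormOn 𝒥 (A l m) (U ⊓ E.cover i : Opens M)) ∧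
    ∀ (x : U) (hi : x.1 ∈ E.cover i) (X : TangentSpace I x.1) (v : E.Fiber x),
      E.fiberEquiv i x hi (t x X v) =
        (Matrix.of fun l m => A l m x X).mulVec (E.fiberEquiv i x hi v)}
  zero_mem' := fun i => ⟨fun _ _ _ => 0, fun _ _ => GenHolFormOn.zero _, fun x hi X v => by
    ext l; simp [Matrix.mulVec, dotProduct]⟩
  add_mem' := by
    intro s t hs ht i
    obtain ⟨f, hf, hf'⟩ := hs i
    obtain ⟨g, hg, hg'⟩ := ht i
    exact ⟨fun l m x => (1 : ℂ) • f l m x + (1 : ℂ) • g l m x,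
      fun l m => (hf l m).lin 1 1 (hg l m), fun x hi X v => by
        ext l
        simp [hf' x hi X v, hg' x hi X v, Matrix.mulVec, dotProduct, add_mul,
          Finset.sum_add_distrib]⟩
  smul_mem' := by
    intro c s hs i
    obtain ⟨f, hf, hf'⟩ := hs i
    exact ⟨fun l m x => c • f l m x + (0 : ℂ) • f l m x,
      fun l m => (hf l m).lin c 0 (hf l m), fun x hi X v => by
        ext l
        simp [hf' x hi X v, Matrix.mulVec, dotProduct, Finset.mul_sum, mul_assoc]⟩

/-- The sheaf of generalized holomorphic sections of `E`. -/
def sections : (Opens M)ᵒᵖ ⥤ ModuleCat ℂ :=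
  presheafOf E.Fiber E.holSections (by
    intro U U' h s hs i
    obtain ⟨f, hf, hf'⟩ := hs i
    exact ⟨f, fun l => (hf l).mono (inf_le_inf_right (E.cover i) h),
      fun x hi l => hf' ⟨x.1, h x.2⟩ hi l⟩)

/-- The sheaf of generalized holomorphic sections of `G^*M ⊗ E`. -/
def forms : (Opens M)ᵒᵖ ⥤ ModuleCat ℂ :=
  presheafOf (fun x => TangentSpace I x →ₗ[ℝ] E.Fiber x) E.holForms (by
    intro U U' h s hs i
    obtain ⟨f, hf, hf'⟩ := hs i
    exact ⟨f, fun l => (hf l).mono (inf_le_inf_right (E.cover i) h),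
      fun x hi X l => hf' ⟨x.1, h x.2⟩ hi X l⟩)

/-- The sheaf of generalized holomorphic sections of `G^*M ⊗ End(E)`. -/
def endForms : (Opens M)ᵒᵖ ⥤ ModuleCat ℂ :=
  presheafOf (fun x => TangentSpace I x →ₗ[ℝ] Module.End ℂ (E.Fiber x)) E.holEndForms (by
    intro U U' h s hs i
    obtain ⟨f, hf, hf'⟩ := hs i
    exact ⟨f, fun l m => (hf l m).mono (inf_le_inf_right (E.cover i) h),
      fun x hi X v => hf' ⟨x.1, h x.2⟩ hi X v⟩)

/-! #### Connections and the Atiyah cocycle -/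

/-- A generalized holomorphic connection on `E`: a `ℂ`-linear map of sheaves
`D : E → G^*M ⊗ E` with `D(f s) = d_+ f ⊗ s + f D(s)` for all local generalized holomorphic
functions `f` and sections `s`. -/
structure Connection where
  /-- the map of sheaves -/
  D : E.sections ⟶ E.forms
  leibniz : ∀ (U : Opens M) (f : M → ℂ) (hf : GenHolOn 𝒥 f U) (s : E.holSections U) (x : U)
    (X : TangentSpace I x.1),
    ((D.app (op U)).hom (E.mulSection hf s)).1 x X =
      covectorPart (dPlus 𝒥 f x) X • s.1 x + f x • ((D.app (op U)).hom s).1 x X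

open Classical in
/-- The matrix `φ_ij(x)` of the transition map `φ_i ∘ φ_j⁻¹` (zero outside `U_i ∩ U_j`). -/
def transition (i j : ι) (x : M) : Matrix (Fin r) (Fin r) ℂ :=
  if h : x ∈ E.cover i ∧ x ∈ E.cover j then
    LinearMap.toMatrix' ((E.fiberEquiv j x h.2).symm.trans (E.fiberEquiv i x h.1)).toLinearMap
  else 0

/-- The matrix `d_+(φ_ij)(X)` at `x`. -/
def dPlusTransition (i j : ι) (x : M) (X : TangentSpace I x) : Matrix (Fin r) (Fin r) ℂ :=
  Matrix.of fun l m => covectorPart (dPlus 𝒥 (fun y => E.transition i j y l m) x) X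

/-- The one-cocycle `c` of the cover `U_i` with values in `G^*M ⊗ End(E)` is
`c_ij = φ_j⁻¹ ∘ (φ_ij⁻¹ d_+(φ_ij)) ∘ φ_j`. -/
def IsAtiyahCocycle (c : Cech.Z1 E.cover E.endForms) : Prop :=
  ∀ (i j : ι) (x : (E.cover i ⊓ E.cover j : Opens M)) (X : TangentSpace I x.1)
    (v : E.Fiber x.1),
    (show E.holEndForms (E.cover i ⊓ E.cover j) from c.1 i j).1 x X v =
      (E.fiberEquiv j x x.2.2).symm
        (((E.transition i j x)⁻¹ * E.dPlusTransition i j x X).mulVec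
          (E.fiberEquiv j x x.2.2 v))

end GenHolBundle
end VB

end GenCplx

end

/-! Write `d_i` for the flat derivative in the `i`-th trivialization, that is `φ_i⁻¹ ∘ d ∘ φ_i`. By
the Leibniz rule a connection on `U_i` is `d_i + β_i` with `β_i` a generalized holomorphic one-form
with values in `End(E)`. Differentiating `s_i = φ_ij s_j` gives `d_i = d_j + α_ij` with `α_ij` the
Atiyah cocycle (`flatDeriv_eq`). So the local connections `d_i + β_i` and `d_j + β_j` agree on `U_i
∩ U_j` exactly when `β_j - β_i = α_ij`. A global connection is therefore the same thing as a cochain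
`β` with coboundary `α`.

For this argument the objects must stay in the generalized holomorphic sheaves. The pointwise input
is linear algebra: `L_-` is maximal isotropic, so a complex covector lies in `L_-` if and only if it
vanishes on `ρ(L_-)`. Hence `f` is generalized holomorphic if and only if `df` takes values in `L_-`
(`genHolOn_iff`), and then `d_+ f = df`, so that ordinary calculus applies. It follows that `df` is
a section of `G^*M` (because `d(df) = 0`) and that the sections of `G^*M` form a module over the
generalized holomorphic functions (`GenHolFormOn.mul`).

The geometric input is that the entries of `φ_ij` are generalized holomorphic
(`genHolOn_transition`). Both `φ_i` and `φ_j` intertwine the structure of the total space with the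
product structure; following a covector of the fibre through both shows that the differentials of
these entries lie in `L_-`. Consequently membership in each sheaf can be tested in a single
trivialization near each point.

For the direct limit, no comparison of `H^1` of the cover with `H^1(M)` is needed. If the class dies
in the limit, the cocycle is a coboundary on some refinement, and the local connections can be glued
over the sets of that refinement just as well (`nonempty_connection`). The implications then close
into a cycle: connection, vanishing on the cover, vanishing in the limit, connection. -/

noncomputable section

namespace GenCplx

/-! ### Calculus of generalized holomorphic functions and one-forms -/

section Calculus

open Filter Topology

variable {W : Type*} [NormedAddCommGroup W] [NormedSpace ℝ W]
  {H : Type*} [TopologicalSpace H] {I : ModelWithCorners ℝ W H}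
  {M : Type*} [TopologicalSpace M] [ChartedSpace H M] [IsManifold I ∞ M]
  {𝒥 : GenComplexStructure I M}

theorem covectorPart_covectorC {x : M} (θ : TangentSpace I x →L[ℝ] ℂ) :
    covectorPart (covectorC θ) = θ := by
  refine ContinuousLinearMap.ext fun w => ?_
  simp only [covectorPart, covectorC]
  exact (by rw [mul_comm]; exact Complex.re_add_im (θ w) :
    ((θ w).re : ℂ) + Complex.I * ((θ w).im : ℂ) = θ w)

theorem GenComplexStructure.pairing_skew (𝒥 : GenComplexStructure I M) {x : M}
    (a b : GenTangent I x) : pairing (𝒥.J x a) b = -pairing a (𝒥.J x b) := by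
  have h := 𝒥.orthogonal x a (𝒥.J x b)
  rw [𝒥.sq] at h
  rw [← h]
  simp only [pairing, Prod.fst_neg, Prod.snd_neg, map_neg, neg_apply]
  ring

theorem pairing_covector {x : M} (α : TangentSpace I x →L[ℝ] ℝ) (a : GenTangent I x) :
    pairing ((0, α) : GenTangent I x) a = α a.1 := by
  simp [pairing]

/-- A covector in `L_-` vanishes on `ρ(L_-)`. -/
theorem apply_anchor_eq_zero {x : M} {θ : TangentSpace I x →L[ℝ] ℂ}
    (hθ : covectorC θ ∈ Lminus 𝒥.J x) {u : GenTangentC I x} (hu : u ∈ Lminus 𝒥.J x) :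
    θ u.1.1 + Complex.I * θ u.2.1 = 0 := by
  obtain ⟨h1, -⟩ := hθ
  obtain ⟨h3, h4⟩ := hu
  have h1' : 𝒥.J x ((0, Complex.reCLM.comp θ) : GenTangent I x) = (0, Complex.imCLM.comp θ) := h1
  have e1 := 𝒥.orthogonal x (0, Complex.reCLM.comp θ) u.1
  rw [h1', h3, pairing_covector, pairing_covector] at e1
  have e2 := 𝒥.pairing_skew (0, Complex.reCLM.comp θ) u.1
  rw [h1', h3, pairing_covector, pairing_covector] at e2
  have e1' : (θ u.2.1).im = (θ u.1.1).re := e1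
  have e2' : (θ u.1.1).im = -(θ u.2.1).re := e2
  apply Complex.ext <;> simp [e1', e2']

/-- Nondegeneracy of the pairing: vectors detect the covector part, and covectors detect the vector
part because continuous functionals separate points. -/
theorem eq_of_pairing_eq {x : M} {a b : GenTangent I x} (h : ∀ c, pairing a c = pairing b c) :
    a = b := by
  obtain ⟨X, ξ⟩ := a
  obtain ⟨Y, η⟩ := b
  have h1 : ξ = η := by
    refine ContinuousLinearMap.ext fun v => ?_
    have := h (v, 0)
    simpa [pairing] using this
  have h2 : X = Y := by
    refine (SeparatingDual.eq_iff_forall_dual_eq (R := ℝ) (V := W)).2 fun g => ?_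
    have := h (0, g)
    simp only [pairing, map_zero, zero_add] at this
    exact this
  rw [h1, h2]

/-- A complex covector which vanishes on `ρ(L_-)` lies in `L_-`. -/
theorem covectorC_mem_of_anchor {x : M} {θ : TangentSpace I x →L[ℝ] ℂ}
    (hθ : ∀ u ∈ Lminus 𝒥.J x, θ u.1.1 + Complex.I * θ u.2.1 = 0) :
    covectorC θ ∈ Lminus 𝒥.J x := by
  have key : 𝒥.J x (0, Complex.imCLM.comp θ) = (0, -Complex.reCLM.comp θ) := by
    refine eq_of_pairing_eq fun a => ?_
    -- Every `a` is the first half of the element `(a, J a)` of `L_-`. The real part of the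
    -- hypothesis on these elements already determines `J` on `Im θ`, by nondegeneracy; `J² = -1`
    -- then gives it on `Re θ`.
    have h := congrArg Complex.re (hθ (a, 𝒥.J x a) ⟨rfl, 𝒥.sq x a⟩)
    rw [𝒥.pairing_skew, pairing_covector, pairing_covector]
    simp at h
    change -(θ (𝒥.J x a).1).im = -(θ a.1).re
    linarith
  rw [covectorC_mem_iff]
  have h2 : ((0, Complex.reCLM.comp θ) : GenTangent I x)
      = -𝒥.J x (0, Complex.imCLM.comp θ) := by
    rw [key]; simp
  rw [h2, (𝒥.J x).map_neg, 𝒥.sq, neg_neg]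

/-- The equation `d_- f = 0` says that `df` annihilates `ρ(L_-)`, which for a covector amounts to
lying in `L_-`. -/
theorem genHolOn_iff {f : M → ℂ} {U : Set M} : GenHolOn 𝒥 f U ↔
    ContMDiffOn I 𝓘(ℝ, ℂ) ∞ f U ∧ ∀ x ∈ U, covectorC (dFun f x) ∈ Lminus 𝒥.J x :=
  and_congr_right fun _ => forall₂_congr fun _ _ =>
    ⟨covectorC_mem_of_anchor, fun h _ hu => apply_anchor_eq_zero h hu⟩

/-- `d_+` projects `df` to `L_-` by `½ (1 + i J)`, and this projector is the identity where `J =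
-i`. -/
theorem covectorPart_dPlus {f : M → ℂ} {x : M} (h : covectorC (dFun f x) ∈ Lminus 𝒥.J x) :
    covectorPart (dPlus 𝒥 f x) = dFun f x := by
  have : dPlus 𝒥 f x = covectorC (dFun f x) := by
    refine Prod.ext ?_ ?_
    · change (1 / 2 : ℝ) • ((covectorC (dFun f x)).1 - 𝒥.J x (covectorC (dFun f x)).2) = _
      rw [h.2, sub_neg_eq_add, ← two_smul ℝ, smul_smul]
      norm_num
    · change (1 / 2 : ℝ) • ((covectorC (dFun f x)).2 + 𝒥.J x (covectorC (dFun f x)).1) = _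
      rw [h.1, ← two_smul ℝ, smul_smul]
      norm_num
  rw [this, covectorPart_covectorC]

/-- For a generalized holomorphic function, `d_+ f = df`. -/
theorem GenHolOn.covectorPart_dPlus {f : M → ℂ} {U : Set M} (hf : GenHolOn 𝒥 f U) {x : M}
    (hx : x ∈ U) : covectorPart (dPlus 𝒥 f x) = dFun f x :=
  GenCplx.covectorPart_dPlus ((genHolOn_iff.1 hf).2 x hx)

/-! #### Locality -/

theorem dFun_congr {F : Type*} [NormedAddCommGroup F] [NormedSpace ℝ F] {f g : M → F} {x : M}
    (h : f =ᶠ[𝓝 x] g) : dFun (I := I) f x = dFun g x := h.mfderiv_eq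

theorem GenHolOn.congr {f g : M → ℂ} {U : Opens M} (hf : GenHolOn 𝒥 f U)
    (h : ∀ x ∈ U, g x = f x) : GenHolOn 𝒥 g U := by
  refine ⟨hf.1.congr h, fun x hx u hu => ?_⟩
  have : dFun (I := I) g x = dFun f x :=
    dFun_congr (Filter.eventuallyEq_of_mem (U.isOpen.mem_nhds hx) h)
  have h1 := hf.2 x hx u hu
  simpa only [anchorDeriv, this] using h1

theorem GenHolOn.sum {κ : Type*} (s : Finset κ) {f : κ → M → ℂ} {U : Opens M}
    (hf : ∀ k ∈ s, GenHolOn 𝒥 (f k) U) : GenHolOn 𝒥 (fun x => ∑ k ∈ s, f k x) U := by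
  classical
  induction s using Finset.induction_on with
  | empty => simpa using GenHolOn.const (𝒥 := 𝒥) 0 (U : Set M)
  | insert a s ha ih =>
    simp only [Finset.sum_insert ha]
    exact (hf a (by simp)).add (ih fun k hk => hf k (by simp [hk]))

theorem extD_congr {F : Type*} [NormedAddCommGroup F] [NormedSpace ℝ F]
    {θ η : ∀ x : M, TangentSpace I x →L[ℝ] F} {x : M} (h : ∀ᶠ y in 𝓝 x, θ y = η y) :
    extD θ x = extD η x := by
  have : formDeriv θ x = formDeriv η x := by
    refine Filter.EventuallyEq.mfderiv_eq ?_
    filter_upwards [h] with y hy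
    simp only [formInChart, hy]
  unfold extD
  rw [this]

/-- All three conditions at a point depend only on the germ of the form there. Agreement is required
only on `V ∩ U`, so that forms extended by zero outside `U` are allowed. -/
theorem GenHolFormOn.of_local {θ : ∀ x : M, TangentSpace I x →L[ℝ] ℂ} {U : Opens M}
    (h : ∀ x ∈ U, ∃ (V : Opens M) (η : ∀ x : M, TangentSpace I x →L[ℝ] ℂ), x ∈ V ∧
      GenHolFormOn 𝒥 η V ∧ ∀ y ∈ V, y ∈ U → θ y = η y) :
    GenHolFormOn 𝒥 θ U := by
  have key : ∀ x ∈ U, ∃ (V : Opens M) (η : ∀ x : M, TangentSpace I x →L[ℝ] ℂ), x ∈ V ∧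
      GenHolFormOn 𝒥 η V ∧ (∀ᶠ y in 𝓝 x, θ y = η y) := by
    intro x hx
    obtain ⟨V, η, hxV, hη, he⟩ := h x hx
    refine ⟨V, η, hxV, hη, ?_⟩
    filter_upwards [U.isOpen.mem_nhds hx, V.isOpen.mem_nhds hxV] with y hU hV using he y hV hU
  refine ⟨?_, fun x hx => ?_, fun x hx l hl w => ?_⟩
  · rw [smoothFormOn_iff]
    intro x hx
    obtain ⟨V, η, hxV, hη, he⟩ := key x hx
    refine ((smoothFormOn_iff.1 hη.1) x hxV).congr_of_eventuallyEq ?_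
    filter_upwards [he] with y hy
    simp only [formInChart, hy]
  · obtain ⟨V, η, hxV, hη, he⟩ := key x hx
    rw [he.self_of_nhds]
    exact hη.2.1 x hxV
  · obtain ⟨V, η, hxV, hη, he⟩ := key x hx
    rw [extD_congr he]
    exact hη.2.2 x hxV l hl w

theorem GenHolFormOn.congr {θ η : ∀ x : M, TangentSpace I x →L[ℝ] ℂ} {U : Opens M}
    (hη : GenHolFormOn 𝒥 η U) (h : ∀ x ∈ U, θ x = η x) : GenHolFormOn 𝒥 θ U :=
  .of_local fun _ hx => ⟨U, η, hx, hη, fun y hy _ => h y hy⟩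

theorem GenHolFormOn.sum {κ : Type*} (s : Finset κ)
    {θ : κ → ∀ x : M, TangentSpace I x →L[ℝ] ℂ} {U : Opens M}
    (hf : ∀ k ∈ s, GenHolFormOn 𝒥 (θ k) U) : GenHolFormOn 𝒥 (fun x => ∑ k ∈ s, θ k x) U := by
  classical
  induction s using Finset.induction_on with
  | empty => simpa using GenHolFormOn.zero (𝒥 := 𝒥) U
  | insert a s ha ih =>
    refine ((hf a (by simp)).lin 1 1 (ih fun k hk => hf k (by simp [hk]))).congr fun x _ => ?_
    rw [Finset.sum_insert ha, one_smul, one_smul]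

/-! #### Products -/

/-- The preferred trivialization at `x` is the identity over `x` itself. This turns the coordinate
product rule into an identity in the values of `θ` at `x`. -/
theorem formInChart_self {F : Type*} [NormedAddCommGroup F] [NormedSpace ℝ F]
    (θ : ∀ x : M, TangentSpace I x →L[ℝ] F) (x : M) : formInChart θ x x = θ x := by
  have h : (trivializationAt W (TangentSpace I : M → Type _) x).symmL ℝ x =
      ContinuousLinearMap.id ℝ W := by
    rw [TangentBundle.symmL_trivializationAt_eq_core (mem_chart_source H x)]
    refine ContinuousLinearMap.ext fun v => ?_
    exact (tangentBundleCore I M).coordChange_self (achart H x) x (mem_chart_source H x) v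
  unfold formInChart
  rw [h]
  rfl

/-- Derivatives are real while the scalars are complex; `G` will be the coordinate expression of a
complex-valued one-form. -/
theorem hasMFDerivAt_smul {F : Type*} [NormedAddCommGroup F] [NormedSpace ℝ F] [NormedSpace ℂ F]
    [IsScalarTower ℝ ℂ F] {f : M → ℂ} {G : M → F} {x : M} {f' : W →L[ℝ] ℂ} {G' : W →L[ℝ] F}
    (hf : HasMFDerivAt I 𝓘(ℝ, ℂ) f x f') (hG : HasMFDerivAt I 𝓘(ℝ, F) G x G') :
    HasMFDerivAt I 𝓘(ℝ, F) (fun y => f y • G y) x (f x • G' + f'.smulRight (G x)) := by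
  have h := HasFDerivWithinAt.smul hf.2 hG.2
  refine ⟨hf.1.smul hG.1, h.congr_fderiv ?_⟩
  simp [writtenInExtChartAt]
  rfl

theorem formDeriv_mul {f : M → ℂ} {θ : ∀ x : M, TangentSpace I x →L[ℝ] ℂ} {x : M}
    (hf : MDifferentiableAt I 𝓘(ℝ, ℂ) f x)
    (hθ : MDifferentiableAt I 𝓘(ℝ, W →L[ℝ] ℂ) (formInChart θ x) x) (v w : W) :
    formDeriv (fun y => f y • θ y) x v w = f x * formDeriv θ x v w + dFun (I := I) f x v * θ x w := by
  have h := (hasMFDerivAt_smul hf.hasMFDerivAt hθ.hasMFDerivAt).mfderiv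
  let D : W →L[ℝ] ℂ := dFun (I := I) f x
  have h4 : formDeriv (fun y => f y • θ y) x =
      f x • formDeriv θ x + D.smulRight (formInChart θ x x) := h
  rw [h4, formInChart_self]
  rfl

/-- Contracting `d(fθ) = df ∧ θ + f dθ` with `ρ(l)`, `l ∈ L_-`, leaves three terms. They vanish
because `f` is generalized holomorphic, because `L_-` is isotropic, and because `θ` is generalized
holomorphic, respectively. -/
theorem GenHolFormOn.mul {f : M → ℂ} {θ : ∀ x : M, TangentSpace I x →L[ℝ] ℂ} {U : Opens M}
    (hf : GenHolOn 𝒥 f U) (hθ : GenHolFormOn 𝒥 θ U) :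
    GenHolFormOn 𝒥 (fun x => f x • θ x) U := by
  have hs := smoothFormOn_iff.1 hθ.1
  refine ⟨?_, fun x hx => ?_, fun x hx l hl w => ?_⟩
  · rw [smoothFormOn_iff]
    intro x hx
    have h : ContDiff ℝ ∞ fun p : ℂ × (W →L[ℝ] ℂ) => p.1 • p.2 :=
      (isBoundedBilinearMap_smul (𝕜 := ℝ) (A := ℂ) (E := W →L[ℝ] ℂ)).contDiff
    exact h.contMDiff.contMDiffAt.comp x
      (((hf.1 x hx).contMDiffAt (U.isOpen.mem_nhds hx)).prodMk_space (hs x hx))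
  · refine covectorC_mem_of_anchor fun u hu => ?_
    have := apply_anchor_eq_zero (hθ.2.1 x hx) hu
    simp only [smul_apply, smul_eq_mul]
    linear_combination f x * this
  · have e : ∀ v : TangentSpace I x, extD (fun y => f y • θ y) x v w =
        f x * extD θ x v w + dFun f x v * θ x w - dFun f x w * θ x v := by
      intro v
      have hd := (hs x hx).mdifferentiableAt (by simp)
      have h1 := formDeriv_mul (hf.mdiff hx) hd v w
      have h2 := formDeriv_mul (hf.mdiff hx) hd w v
      have h5 : ∀ (κ : ∀ x : M, TangentSpace I x →L[ℝ] ℂ), extD κ x v w =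
        formDeriv κ x v w - formDeriv κ x w v := fun _ => rfl
      rw [h5, h5, mul_sub]
      refine (congrArg₂ (· - ·) h1 h2).trans ?_
      ring
    rw [e, e]
    have h1 := apply_anchor_eq_zero (hθ.2.1 x hx) hl
    have h2 := hf.2 x hx l hl
    have h3 := hθ.2.2 x hx l hl w
    simp only [anchorDeriv] at h2
    linear_combination f x * h3 + θ x w * h2 - dFun f x w * h1

/-! #### Differentials of functions -/

variable [I.Boundaryless]

/-- The trivialization of the tangent bundle attached to a chart is the derivative of the inverse
chart, so this is the chain rule. Without boundary, derivatives within the range of the model are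
ordinary derivatives. -/
theorem formInChart_dFun {F : Type*} [NormedAddCommGroup F] [NormedSpace ℝ F] {f : M → F}
    {x y : M} (hy : y ∈ (chartAt H x).source) (hf : MDifferentiableAt I 𝓘(ℝ, F) f y) :
    formInChart (dFun (I := I) f) x y =
      fderiv ℝ (f ∘ (extChartAt I x).symm) (extChartAt I x y) := by
  have hy' : y ∈ (extChartAt I x).source := by simpa using hy
  have ht : extChartAt I x y ∈ (extChartAt I x).target := (extChartAt I x).map_source hy'
  have h1 := (mdifferentiableWithinAt_extChartAt_symm (I := I) ht)
  rw [I.range_eq_univ, mdifferentiableWithinAt_univ] at h1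
  have e : (extChartAt I x).symm (extChartAt I x y) = y := (extChartAt I x).left_inv hy'
  have h2 := mfderiv_comp (I := 𝓘(ℝ, W)) (I' := I) (I'' := 𝓘(ℝ, F))
    (extChartAt I x y) (by rwa [e] : MDifferentiableAt I 𝓘(ℝ, F) f _) h1
  rw [mfderiv_eq_fderiv] at h2
  rw [h2, e]
  unfold formInChart
  rw [TangentBundle.symmL_trivializationAt hy, I.range_eq_univ, mfderivWithin_univ]
  rfl

theorem contDiffAt_comp_extChartAt_symm {F : Type*} [NormedAddCommGroup F] [NormedSpace ℝ F]
    {f : M → F} {x : M} (hf : ContMDiffAt I 𝓘(ℝ, F) ∞ f x) :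
    ContDiffAt ℝ ∞ (f ∘ (extChartAt I x).symm) (extChartAt I x x) := by
  have h1 := contMDiffWithinAt_extChartAt_symm_range (I := I) (n := ∞) x
    (mem_extChartAt_target (I := I) x)
  rw [I.range_eq_univ, contMDiffWithinAt_univ] at h1
  refine contMDiffAt_iff_contDiffAt.1 (ContMDiffAt.comp (I' := I) _ ?_ h1)
  rwa [extChartAt_to_inv]

theorem formInChart_dFun_eventuallyEq {F : Type*} [NormedAddCommGroup F] [NormedSpace ℝ F]
    {f : M → F} {U : Opens M} (hf : ContMDiffOn I 𝓘(ℝ, F) ∞ f U) {x : M} (hx : x ∈ U) :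
    formInChart (dFun (I := I) f) x =ᶠ[𝓝 x]
      fderiv ℝ (f ∘ (extChartAt I x).symm) ∘ extChartAt I x := by
  filter_upwards [U.isOpen.mem_nhds hx, chart_source_mem_nhds H x] with y hU hy
  exact formInChart_dFun hy
    (((hf y hU).contMDiffAt (U.isOpen.mem_nhds hU)).mdifferentiableAt (by simp))

theorem smoothFormOn_dFun {F : Type*} [NormedAddCommGroup F] [NormedSpace ℝ F]
    {f : M → F} {U : Opens M} (hf : ContMDiffOn I 𝓘(ℝ, F) ∞ f U) :
    SmoothFormOn (dFun (I := I) f) U := by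
  rw [smoothFormOn_iff]
  intro x hx
  refine ContMDiffAt.congr_of_eventuallyEq ?_ (formInChart_dFun_eventuallyEq hf hx)
  have h := contDiffAt_comp_extChartAt_symm ((hf x hx).contMDiffAt (U.isOpen.mem_nhds hx))
  exact (h.fderiv_right (m := ∞) (by simp)).contMDiffAt.comp x contMDiffAt_extChartAt

/-- `d(df) = 0`, by symmetry of the second derivative of the coordinate expression of `f`. -/
theorem extD_dFun {F : Type*} [NormedAddCommGroup F] [NormedSpace ℝ F]
    {f : M → F} {U : Opens M} (hf : ContMDiffOn I 𝓘(ℝ, F) ∞ f U) {x : M} (hx : x ∈ U)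
    (v w : TangentSpace I x) : extD (dFun (I := I) f) x v w = 0 := by
  have h := contDiffAt_comp_extChartAt_symm ((hf x hx).contMDiffAt (U.isOpen.mem_nhds hx))
  have h1 : DifferentiableAt ℝ (fderiv ℝ (f ∘ (extChartAt I x).symm)) (extChartAt I x x) :=
    (h.fderiv_right (m := ∞) (by simp)).differentiableAt (by simp)
  have h2 : formDeriv (dFun (I := I) f) x =
      fderiv ℝ (fderiv ℝ (f ∘ (extChartAt I x).symm)) (extChartAt I x x) := by
    refine (formInChart_dFun_eventuallyEq hf hx).mfderiv_eq.trans ?_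
    -- The derivative of the chart at its own base point is the identity, so no Jacobian remains.
    rw [mfderiv_comp x h1.mdifferentiableAt (mdifferentiableAt_extChartAt (mem_chart_source H x)),
      mfderiv_eq_fderiv, mfderiv_extChartAt_self]
    rfl
  have h3 : IsSymmSndFDerivAt ℝ (f ∘ (extChartAt I x).symm) (extChartAt I x x) :=
    h.isSymmSndFDerivAt (by simpa using ENat.LEInfty.out)
  have h4 : extD (dFun (I := I) f) x v w =
    formDeriv (dFun (I := I) f) x v w - formDeriv (dFun (I := I) f) x w v := rfl
  rw [h4, h2]
  exact sub_eq_zero.2 (h3 v w)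

/-- This puts the entries of `d φ_ij` and the flat derivatives of sections into the sheaf `G^*M`. -/
theorem GenHolOn.genHolFormOn_dFun {f : M → ℂ} {U : Opens M} (hf : GenHolOn 𝒥 f U) :
    GenHolFormOn 𝒥 (dFun f) U := by
  refine ⟨smoothFormOn_dFun hf.1, (genHolOn_iff.1 hf).2, fun x hx l _ w => ?_⟩
  rw [extD_dFun hf.1 hx, extD_dFun hf.1 hx, mul_zero, add_zero]

end Calculus

/-! ### The transition maps are generalized holomorphic -/

section Transition

variable {W : Type} [NormedAddCommGroup W] [NormedSpace ℝ W]
  {H : Type*} [TopologicalSpace H] {I : ModelWithCorners ℝ W H}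
  {M : Type*} [TopologicalSpace M] [ChartedSpace H M] [IsManifold I ∞ M]
  {𝒥 : GenComplexStructure I M} {r : ℕ} {V : M → Type*}
  [∀ x, AddCommGroup (V x)] [∀ x, Module ℝ (V x)] [∀ x, TopologicalSpace (V x)]
  [TopologicalSpace (TotalSpace (Fin r → ℂ) V)] [FiberBundle (Fin r → ℂ) V]
  [VectorBundle ℝ (Fin r → ℂ) V] [ContMDiffVectorBundle ∞ (Fin r → ℂ) V I] {ι : Type*}
  (E : GenHolBundle 𝒥 r V ι)

/-- The value of `J` on the base component enters through an equation, so that it can either be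
computed beforehand or be left unevaluated by `rfl`. -/
theorem prodJ_covector {F : Type*} [NormedAddCommGroup F] [NormedSpace ℝ F]
    (J : ∀ x : M, GenTangent I x → GenTangent I x) (j : F →L[ℝ] F) (q : M × F)
    (ξ : W × F →L[ℝ] ℝ) {b : W × (W →L[ℝ] ℝ)}
    (hb : J q.1 ((0, ξ.comp (ContinuousLinearMap.inl ℝ W F)) : W × (W →L[ℝ] ℝ)) = b) :
    prodJ J j q (((0 : W × F), ξ) : (W × F) × (W × F →L[ℝ] ℝ)) =
      (((b.1, 0) : W × F),
        b.2.coprod (-((ξ.comp (ContinuousLinearMap.inr ℝ W F)).comp j))) := by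
  subst hb
  exact Prod.ext (Prod.ext rfl j.map_zero) rfl

namespace GenHolBundle

theorem mdifferentiable_triv (i : ι) :
    OpenPartialHomeomorph.MDifferentiable (I.prod 𝓘(ℝ, Fin r → ℂ)) (I.prod 𝓘(ℝ, Fin r → ℂ))
      (E.triv i).toOpenPartialHomeomorph :=
  ⟨(E.genHol i).smooth.mdifferentiableOn (by simp),
    (E.genHol i).smooth_symm.mdifferentiableOn (by simp)⟩

/-- The derivative of the vector part of a trivialization. -/
def vertDeriv (i : ι) (p : TotalSpace (Fin r → ℂ) V) : W × (Fin r → ℂ) →L[ℝ] (Fin r → ℂ) :=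
  (ContinuousLinearMap.snd ℝ W (Fin r → ℂ)).comp
    (mfderiv (I.prod 𝓘(ℝ, Fin r → ℂ)) (I.prod 𝓘(ℝ, Fin r → ℂ))
      (E.triv i).toOpenPartialHomeomorph p)

/-- The complex structure of the total space on the pullback of a covector of the fibre. -/
theorem total_J_vertDeriv (i : ι) {p : TotalSpace (Fin r → ℂ) V} (hp : p ∈ (E.triv i).source)
    (τ : (Fin r → ℂ) →L[ℝ] ℝ) :
    E.total.J p ((0, τ.comp (E.vertDeriv i p)) : GenTangent (I.prod 𝓘(ℝ, Fin r → ℂ)) p) =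
      (0, (-(τ.comp (stdJ r))).comp (E.vertDeriv i p)) := by
  let A : W × (Fin r → ℂ) →L[ℝ] W × (Fin r → ℂ) :=
    mfderiv (I.prod 𝓘(ℝ, Fin r → ℂ)) (I.prod 𝓘(ℝ, Fin r → ℂ))
      (E.triv i).toOpenPartialHomeomorph p
  let A' : W × (Fin r → ℂ) →L[ℝ] W × (Fin r → ℂ) :=
    mfderiv (I.prod 𝓘(ℝ, Fin r → ℂ)) (I.prod 𝓘(ℝ, Fin r → ℂ))
      (E.triv i).toOpenPartialHomeomorph.symm ((E.triv i).toOpenPartialHomeomorph p)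
  have h1 : ∀ w, A' (A w) = w := fun w =>
    DFunLike.congr_fun ((E.mdifferentiable_triv i).symm_comp_deriv hp) w
  have h2 : ∀ w, A (A' w) = w := by
    intro w
    have h := (E.mdifferentiable_triv i).comp_symm_deriv
      ((E.triv i).toOpenPartialHomeomorph.map_source hp)
    rw [(E.triv i).toOpenPartialHomeomorph.left_inv hp] at h
    exact DFunLike.congr_fun h w
  have hc := (E.genHol i).comm p hp (0, τ.comp (E.vertDeriv i p))
  have hpush : pushGen (I' := I.prod 𝓘(ℝ, Fin r → ℂ)) (E.triv i).toOpenPartialHomeomorph p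
      ((0, τ.comp (E.vertDeriv i p)) : GenTangent (I.prod 𝓘(ℝ, Fin r → ℂ)) p) =
      (0, τ.comp (ContinuousLinearMap.snd ℝ W (Fin r → ℂ))) := by
    refine Prod.ext A.map_zero (ContinuousLinearMap.ext fun w => ?_)
    exact congrArg (fun u : W × (Fin r → ℂ) => τ u.2) (h2 w)
  rw [hpush] at hc
  -- After the pushforward the covector is `τ ∘ snd`, which vanishes in the directions of `M`. Only
  -- the standard structure of `ℂ^r` acts on it, whatever `𝒥` is.
  have hz : (τ.comp (ContinuousLinearMap.snd ℝ W (Fin r → ℂ))).comp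
      (ContinuousLinearMap.inl ℝ W (Fin r → ℂ)) = 0 := by
    ext w; simp
  have hJ : 𝒥.J ((E.triv i).toOpenPartialHomeomorph p).1
    ((0, (τ.comp (ContinuousLinearMap.snd ℝ W (Fin r → ℂ))).comp
      (ContinuousLinearMap.inl ℝ W (Fin r → ℂ))) : W × (W →L[ℝ] ℝ)) =
      ((0, 0) : W × (W →L[ℝ] ℝ)) := by
    rw [hz]
    exact (𝒥.J _).map_zero
  set b := E.total.J p ((0, τ.comp (E.vertDeriv i p)) : GenTangent (I.prod 𝓘(ℝ, Fin r → ℂ)) p)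
  have hc' := hc.trans (prodJ_covector (fun x => 𝒥.J x) (stdJ r)
    ((E.triv i).toOpenPartialHomeomorph p) _ hJ)
  have hb1 : A b.1 = 0 := congrArg Prod.fst hc'
  have hb2 : ∀ w : W × (Fin r → ℂ), b.2 (A' w) = -τ (stdJ r w.2) := by
    intro w
    have h := congrArg (fun c : (W × (Fin r → ℂ)) × (W × (Fin r → ℂ) →L[ℝ] ℝ) => c.2 w) hc'
    refine h.trans ?_
    simp
  refine Prod.ext ?_ (ContinuousLinearMap.ext fun w => ?_)
  · exact (h1 b.1).symm.trans ((congrArg A' hb1).trans A'.map_zero)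
  · exact (congrArg b.2 (h1 w)).symm.trans (hb2 (A w))

/-- The differential of the `l`-th component of `φ_i ∘ φ_j⁻¹` in the direction of `M` lies in
`L_-`. -/
theorem covectorC_dFun_mem (i j : ι) {p : TotalSpace (Fin r → ℂ) V}
    (hi : p ∈ (E.triv i).source) (hj : p ∈ (E.triv j).source) (l : Fin r) :
    ∀ q : M × (Fin r → ℂ), E.triv j p = q →
    covectorC (dFun (I := I) (fun y => (E.triv i
      ((E.triv j).toOpenPartialHomeomorph.symm (y, q.2))).2 l) q.1) ∈ Lminus 𝒥.J q.1 := by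
  rintro _ rfl
  let N := Fin r → ℂ
  let B' : W × N →L[ℝ] W × N :=
    mfderiv (I.prod 𝓘(ℝ, N)) (I.prod 𝓘(ℝ, N))
      (E.triv j).toOpenPartialHomeomorph.symm (E.triv j p)
  let C : W →L[ℝ] N := ((E.vertDeriv i p).comp B').comp (ContinuousLinearMap.inl ℝ W N)
  -- Here `C` is the derivative of `y ↦ φ_i φ_j⁻¹(y, w)` along `M`, where `w` is the vector part of
  -- `φ_j p`. The action of the total structure on `τ ∘ dφ_i` is known from the `i`-th
  -- trivialization. Transported by `φ_j` and restricted to the directions of `M`, it becomes a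
  -- statement about `𝒥` alone, since the product structure does not mix the two factors.
  have key : ∀ τ : N →L[ℝ] ℝ, 𝒥.J (E.triv j p).1 ((0, τ.comp C) : W × (W →L[ℝ] ℝ)) =
      ((0, (-(τ.comp (stdJ r))).comp C) : W × (W →L[ℝ] ℝ)) := by
    intro τ
    have hc := (E.genHol j).comm p hj (0, τ.comp (E.vertDeriv i p))
    let B : W × N →L[ℝ] W × N := mfderiv (I.prod 𝓘(ℝ, N)) (I.prod 𝓘(ℝ, N))
      (E.triv j).toOpenPartialHomeomorph p
    have hpush : ∀ σ : N →L[ℝ] ℝ,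
        pushGen (I' := I.prod 𝓘(ℝ, N)) (E.triv j).toOpenPartialHomeomorph p
        ((0, σ.comp (E.vertDeriv i p)) : GenTangent (I.prod 𝓘(ℝ, N)) p) =
        (((0 : W × N), (σ.comp (E.vertDeriv i p)).comp B') : (W × N) × (W × N →L[ℝ] ℝ)) :=
      fun σ => Prod.ext B.map_zero rfl
    have hc' := (hpush (-(τ.comp (stdJ r)))).symm.trans
      ((congrArg (pushGen (I' := I.prod 𝓘(ℝ, N)) (E.triv j).toOpenPartialHomeomorph p)
        (E.total_J_vertDeriv i hi τ)).symm.trans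
      (hc.trans ((congrArg _ (hpush τ)).trans
        (prodJ_covector (fun x => 𝒥.J x) (stdJ r) (E.triv j p) _ rfl))))
    refine Prod.ext ?_ (ContinuousLinearMap.ext fun w => ?_)
    · exact (congrArg (fun c : (W × N) × (W × N →L[ℝ] ℝ) => c.1.1) hc').symm
    · have h := congrArg (fun c : (W × N) × (W × N →L[ℝ] ℝ) => c.2 (w, 0)) hc'
      refine Eq.trans ?_ h.symm
      refine Eq.trans ?_ (ContinuousLinearMap.coprod_apply _ _ _).symm
      rw [map_zero, add_zero]
      rfl
  have hd : dFun (I := I) (fun y => (E.triv i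
      ((E.triv j).toOpenPartialHomeomorph.symm (y, (E.triv j p).2))).2 l) (E.triv j p).1 =
      (ContinuousLinearMap.proj (R := ℝ) (φ := fun _ : Fin r => ℂ) l).comp C := by
    have e : (E.triv j).toOpenPartialHomeomorph.symm (E.triv j p) = p :=
      (E.triv j).toOpenPartialHomeomorph.left_inv hj
    have h1 : HasMFDerivAt I (I.prod 𝓘(ℝ, N)) (fun y : M => (y, (E.triv j p).2)) (E.triv j p).1
        ((ContinuousLinearMap.id ℝ W).prod 0) :=
      (hasMFDerivAt_id (I := I) (E.triv j p).1).prodMk (hasMFDerivAt_const (E.triv j p).2 _)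
    have h2 := ((E.mdifferentiable_triv j).mdifferentiableAt_symm
      ((E.triv j).toOpenPartialHomeomorph.map_source hj)).hasMFDerivAt
    let A : W × N →L[ℝ] W × N := mfderiv (I.prod 𝓘(ℝ, N)) (I.prod 𝓘(ℝ, N))
      (E.triv i).toOpenPartialHomeomorph p
    have h3 : HasMFDerivAt (I.prod 𝓘(ℝ, N)) (I.prod 𝓘(ℝ, N))
        (E.triv i).toOpenPartialHomeomorph
        ((E.triv j).toOpenPartialHomeomorph.symm (E.triv j p)) A := by
      rw [e]
      exact ((E.mdifferentiable_triv i).mdifferentiableAt hi).hasMFDerivAt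
    have h4 := (h3.comp (E.triv j p) h2).comp (E.triv j p).1 h1
    have h6 := HasMFDerivAt.comp (E.triv j p).1 (hasMFDerivAt_snd (I := I) (I' := 𝓘(ℝ, N)) _) h4
    have h7 := (ContinuousLinearMap.proj (R := ℝ) (φ := fun _ : Fin r => ℂ) l).hasMFDerivAt.comp
      (E.triv j p).1 h6
    exact h7.mfderiv
  rw [covectorC_mem_iff]
  -- Take `τ` to be the real part of the `l`-th coordinate; then `-τ(i z)` is the imaginary part of
  -- `z_l`, as membership in `L_-` demands.
  refine Eq.trans ?_ ((key (Complex.reCLM.comp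
    (ContinuousLinearMap.proj (R := ℝ) (φ := fun _ : Fin r => ℂ) l))).trans ?_)
  · rw [hd]
    rfl
  · rw [hd]
    refine Prod.ext rfl (ContinuousLinearMap.ext fun w => ?_)
    exact (by simp : -(Complex.I * C w l).re = (C w l).im)

theorem transition_mulVec {i j : ι} {x : M} (hi : x ∈ E.cover i) (hj : x ∈ E.cover j)
    (w : Fin r → ℂ) :
    (E.transition i j x).mulVec w = E.fiberEquiv i x hi ((E.fiberEquiv j x hj).symm w) := by
  unfold transition
  rw [dif_pos ⟨hi, hj⟩, LinearMap.toMatrix'_mulVec]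
  rfl

theorem transition_mulVec_fiberEquiv {i j : ι} {x : M} (hi : x ∈ E.cover i)
    (hj : x ∈ E.cover j) (v : E.Fiber x) :
    (E.transition i j x).mulVec (E.fiberEquiv j x hj v) = E.fiberEquiv i x hi v := by
  rw [E.transition_mulVec hi hj, LinearEquiv.symm_apply_apply]

theorem transition_mul {i j k : ι} {x : M} (hi : x ∈ E.cover i) (hj : x ∈ E.cover j)
    (hk : x ∈ E.cover k) : E.transition i j x * E.transition j k x = E.transition i k x := by
  refine Matrix.mulVec_injective (funext fun w => ?_)
  rw [← Matrix.mulVec_mulVec, E.transition_mulVec hj hk, E.transition_mulVec hi hj,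
    E.transition_mulVec hi hk, LinearEquiv.symm_apply_apply]

theorem transition_self {i : ι} {x : M} (hi : x ∈ E.cover i) : E.transition i i x = 1 := by
  refine Matrix.mulVec_injective (funext fun w => ?_)
  rw [E.transition_mulVec hi hi, LinearEquiv.apply_symm_apply, Matrix.one_mulVec]

theorem transition_inv {i j : ι} {x : M} (hi : x ∈ E.cover i) (hj : x ∈ E.cover j) :
    (E.transition i j x)⁻¹ = E.transition j i x :=
  Matrix.inv_eq_right_inv (by rw [E.transition_mul hi hj hi, E.transition_self hi])

/-- Identifies the matrix, defined fibre by fibre, with the map `φ_i ∘ φ_j⁻¹` on the total space,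
where smoothness and compatibility with the structures are known. -/
theorem transition_mulVec_eq_triv {i j : ι} {x : M} (hi : x ∈ E.cover i) (hj : x ∈ E.cover j)
    (w : Fin r → ℂ) :
    (E.transition i j x).mulVec w =
      (E.triv i ((E.triv j).toOpenPartialHomeomorph.symm (x, w))).2 := by
  have hlj := E.linear j
  rw [E.transition_mulVec hi hj, ← (E.triv j).mk_symm hj w]
  rfl

/-- The entries of the transition maps are generalized holomorphic functions. -/
theorem genHolOn_transition (i j : ι) (l m : Fin r) :
    GenHolOn 𝒥 (fun x => E.transition i j x l m) (E.cover i ⊓ E.cover j : Opens M) := by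
  -- The basis vector `w` selects the `m`-th column, so that `f` is the entry `(l, m)` on the
  -- overlap.
  let w : Fin r → ℂ := Pi.single m 1
  let f : M → ℂ := fun y => (E.triv i
      ((E.triv j).toOpenPartialHomeomorph.symm (y, w))).2 l
  have hsrc : ∀ x ∈ E.cover i ⊓ E.cover j,
      (E.triv j).toOpenPartialHomeomorph.symm (x, w) ∈ (E.triv i).source := by
    intro x hx
    rw [(E.triv i).mem_source, (E.triv j).proj_symm_apply' hx.2]
    exact hx.1
  have htgt : ∀ x ∈ E.cover i ⊓ E.cover j, (x, w) ∈ (E.triv j).target := fun x hx =>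
    (E.triv j).mem_target.2 hx.2
  have hf : GenHolOn 𝒥 f (E.cover i ⊓ E.cover j : Opens M) := by
    rw [genHolOn_iff]
    constructor
    · have h1 : ContMDiffOn I (I.prod 𝓘(ℝ, Fin r → ℂ)) ∞ (fun y : M => (y, w))
          (E.cover i ⊓ E.cover j : Opens M) := contMDiffOn_id.prodMk contMDiffOn_const
      have h2 := (E.genHol i).smooth.comp ((E.genHol j).smooth_symm.comp h1 htgt) hsrc
      exact (ContinuousLinearMap.contMDiff
        (ContinuousLinearMap.proj (R := ℝ) (φ := fun _ : Fin r => ℂ) l)).comp_contMDiffOn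
        (contMDiff_snd.comp_contMDiffOn h2)
    · intro x hx
      exact E.covectorC_dFun_mem i j (hsrc x hx)
        ((E.triv j).toOpenPartialHomeomorph.map_target (htgt x hx)) l (x, w)
        ((E.triv j).toOpenPartialHomeomorph.right_inv (htgt x hx))
  refine hf.congr fun x hx => ?_
  have h := congrFun (E.transition_mulVec_eq_triv hx.1 hx.2 w) l
  simpa [w] using h

end GenHolBundle

end Transition

/-! ### Membership in the sheaves is local and independent of the trivialization -/

section Gluing

variable {W : Type} [NormedAddCommGroup W] [NormedSpace ℝ W]
  {H : Type*} [TopologicalSpace H] {I : ModelWithCorners ℝ W H}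
  {M : Type*} [TopologicalSpace M] [ChartedSpace H M] [IsManifold I ∞ M]
  {𝒥 : GenComplexStructure I M} {r : ℕ} {V : M → Type*}
  [∀ x, AddCommGroup (V x)] [∀ x, Module ℝ (V x)] [∀ x, TopologicalSpace (V x)]
  [TopologicalSpace (TotalSpace (Fin r → ℂ) V)] [FiberBundle (Fin r → ℂ) V]
  [VectorBundle ℝ (Fin r → ℂ) V] [ContMDiffVectorBundle ∞ (Fin r → ℂ) V I] {ι : Type*}
  (E : GenHolBundle 𝒥 r V ι)

namespace GenHolBundle

/-! #### Local criteria for generalized holomorphic sections -/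

open Classical in
/-- The `l`-th component in the `i`-th trivialization of a section over `U`, extended by zero. -/
def component {U : Opens M} (s : (x : U) → E.Fiber x) (i : ι) (l : Fin r) (x : M) : ℂ :=
  if h : x ∈ U ∧ x ∈ E.cover i then E.fiberEquiv i x h.2 (s ⟨x, h.1⟩) l else 0

theorem component_apply {U : Opens M} (s : (x : U) → E.Fiber x) {i : ι} (l : Fin r) {x : M}
    (hx : x ∈ U) (hi : x ∈ E.cover i) :
    E.component s i l x = E.fiberEquiv i x hi (s ⟨x, hx⟩) l :=
  dif_pos ⟨hx, hi⟩

theorem genHolOn_component {U : Opens M} (s : E.holSections U) (i : ι) (l : Fin r) :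
    GenHolOn 𝒥 (E.component s.1 i l) (U ⊓ E.cover i : Opens M) := by
  obtain ⟨f, hf, hf'⟩ := s.2 i
  refine (hf l).congr fun x hx => ?_
  rw [E.component_apply _ _ hx.1 hx.2]
  exact hf' ⟨x, hx.1⟩ hx.2 l

theorem _root_.GenCplx.GenHolOn.of_local {f : M → ℂ} {U : Opens M}
    (h : ∀ x ∈ U, ∃ (V : Opens M) (g : M → ℂ), x ∈ V ∧
      GenHolOn 𝒥 g V ∧ ∀ y ∈ V, y ∈ U → f y = g y) :
    GenHolOn 𝒥 f U := by
  have key : ∀ x ∈ U, ∃ V : Opens M, x ∈ V ∧ GenHolOn 𝒥 f V := by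
    intro x hx
    obtain ⟨V, g, hxV, hg, he⟩ := h x hx
    exact ⟨V ⊓ U, ⟨hxV, hx⟩, GenHolOn.congr (hg.mono inf_le_left) fun y hy => he y hy.1 hy.2⟩
  refine ⟨fun x hx => ?_, fun x hx => ?_⟩
  · obtain ⟨V, hxV, hf⟩ := key x hx
    exact ((hf.1 x hxV).contMDiffAt (V.isOpen.mem_nhds hxV)).contMDiffWithinAt
  · obtain ⟨V, hxV, hf⟩ := key x hx
    exact hf.2 x hxV

/-- One trivialization near each point suffices: components in any other one are obtained by
multiplying with a matrix of generalized holomorphic functions. -/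
theorem mem_holSections_of_local {U : Opens M} {s : (x : U) → E.Fiber x}
    (h : ∀ x : U, ∃ (V : Opens M) (j : ι) (f : Fin r → M → ℂ), x.1 ∈ V ∧
      (∀ l, GenHolOn 𝒥 (f l) V) ∧ ∃ hV : V ≤ E.cover j, ∀ (y : U) (hy : y.1 ∈ V) (l : Fin r),
        E.fiberEquiv j y (hV hy) (s y) l = f l y) :
    s ∈ E.holSections U := by
  intro i
  refine ⟨E.component s i, fun l => GenHolOn.of_local fun x hx => ?_,
    fun x hi l => (E.component_apply s l x.2 hi).symm⟩
  obtain ⟨V, j, f, hxV, hf, hV, he⟩ := h ⟨x, hx.1⟩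
  refine ⟨V ⊓ (E.cover i ⊓ E.cover j), fun y => ∑ a, E.transition i j y l a * f a y,
    ⟨hxV, hx.2, hV hxV⟩, GenHolOn.sum _ fun a _ => GenHolOn.mul
      ((E.genHolOn_transition i j l a).mono inf_le_right) ((hf a).mono inf_le_left), ?_⟩
  intro y hy hyU
  rw [E.component_apply s l hyU.1 hyU.2, ← E.transition_mulVec_fiberEquiv hyU.2 (hV hy.1)]
  simp only [Matrix.mulVec, dotProduct, he ⟨y, hyU.1⟩ hy.1]

variable [FiniteDimensional ℝ W]

/-- A real linear map from a tangent space, composed with the `l`-th component. -/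
def formComponent {x : M} (t : TangentSpace I x →ₗ[ℝ] E.Fiber x) (i : ι)
    (hi : x ∈ E.cover i) (l : Fin r) : TangentSpace I x →L[ℝ] ℂ :=
  haveI : FiniteDimensional ℝ (TangentSpace I x) := inferInstanceAs (FiniteDimensional ℝ W)
  haveI : T2Space (TangentSpace I x) := inferInstanceAs (T2Space W)
  LinearMap.toContinuousLinearMap
    ((LinearMap.proj (R := ℝ) (φ := fun _ : Fin r => ℂ) l).comp
      (((E.fiberEquiv i x hi).toLinearMap.restrictScalars ℝ).comp t))

theorem formComponent_apply {x : M} (t : TangentSpace I x →ₗ[ℝ] E.Fiber x) (i : ι)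
    (hi : x ∈ E.cover i) (l : Fin r) (X : TangentSpace I x) :
    E.formComponent t i hi l X = E.fiberEquiv i x hi (t X) l := rfl

open Classical in
-- The components of a one-form change by `φ_ij`, and `G^*M` is stable under multiplication by its
-- entries. Finite dimension makes the components, given only as linear maps on tangent spaces,
-- continuous.
theorem mem_holForms_of_local {U : Opens M}
    {t : (x : U) → TangentSpace I x.1 →ₗ[ℝ] E.Fiber x}
    (h : ∀ x : U, ∃ (V : Opens M) (j : ι) (θ : Fin r → ∀ x : M, TangentSpace I x →L[ℝ] ℂ),
      x.1 ∈ V ∧ (∀ l, GenHolFormOn 𝒥 (θ l) V) ∧ ∃ hV : V ≤ E.cover j,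
        ∀ (y : U) (hy : y.1 ∈ V) (X : TangentSpace I y.1) (l : Fin r),
          E.fiberEquiv j y (hV hy) (t y X) l = θ l y X) :
    t ∈ E.holForms U := by
  intro i
  refine ⟨fun l x => if h : x ∈ U ∧ x ∈ E.cover i then
    E.formComponent (t ⟨x, h.1⟩) i h.2 l else 0, fun l => GenHolFormOn.of_local fun x hx => ?_,
    fun x hi X l => ?_⟩
  · obtain ⟨V, j, θ, hxV, hθ, hV, he⟩ := h ⟨x, hx.1⟩
    refine ⟨V ⊓ (E.cover i ⊓ E.cover j), fun y => ∑ a, E.transition i j y l a • θ a y,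
      ⟨hxV, hx.2, hV hxV⟩, GenHolFormOn.sum _ fun a _ => GenHolFormOn.mul
        ((E.genHolOn_transition i j l a).mono inf_le_right) ((hθ a).mono inf_le_left), ?_⟩
    intro y hy hyU
    refine (dif_pos hyU).trans (ContinuousLinearMap.ext fun X => ?_)
    rw [formComponent_apply, ← E.transition_mulVec_fiberEquiv hyU.2 (hV hy.1)]
    simp only [Matrix.mulVec, dotProduct, he ⟨y, hyU.1⟩ hy.1, sum_apply, smul_apply, smul_eq_mul]
  · have h1 : x.1 ∈ U ∧ x.1 ∈ E.cover i := ⟨x.2, hi⟩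
    simp only [dif_pos h1]
    rfl

/-- The `l`-th component of `t` applied to the `m`-th frame vector. -/
def endComponent {x : M} (t : TangentSpace I x →ₗ[ℝ] Module.End ℂ (E.Fiber x)) (i : ι)
    (hi : x ∈ E.cover i) (l m : Fin r) : TangentSpace I x →L[ℝ] ℂ :=
  E.formComponent
    (((LinearMap.applyₗ ((E.fiberEquiv i x hi).symm (Pi.single m 1))).restrictScalars ℝ).comp t)
    i hi l

theorem endComponent_apply {x : M} (t : TangentSpace I x →ₗ[ℝ] Module.End ℂ (E.Fiber x)) (i : ι)
    (hi : x ∈ E.cover i) (l m : Fin r) (X : TangentSpace I x) :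
    E.endComponent t i hi l m X =
      E.fiberEquiv i x hi (t X ((E.fiberEquiv i x hi).symm (Pi.single m 1))) l := rfl

theorem endComponent_mulVec {x : M} (t : TangentSpace I x →ₗ[ℝ] Module.End ℂ (E.Fiber x))
    (i : ι) (hi : x ∈ E.cover i) (X : TangentSpace I x) (v : E.Fiber x) :
    (Matrix.of fun l m => E.endComponent t i hi l m X).mulVec (E.fiberEquiv i x hi v) =
      E.fiberEquiv i x hi (t X v) := by
  have h : (Matrix.of fun l m => E.endComponent t i hi l m X) = LinearMap.toMatrix'
      ((E.fiberEquiv i x hi).toLinearMap ∘ₗ t X ∘ₗ (E.fiberEquiv i x hi).symm.toLinearMap) := by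
    ext l m
    rw [LinearMap.toMatrix'_apply]
    simp [endComponent_apply]
  rw [h, LinearMap.toMatrix'_mulVec]
  simp

open Classical in
theorem mem_holEndForms_of_local {U : Opens M}
    {t : (x : U) → TangentSpace I x.1 →ₗ[ℝ] Module.End ℂ (E.Fiber x)}
    (h : ∀ x : U, ∃ (V : Opens M) (j : ι)
      (A : Fin r → Fin r → ∀ x : M, TangentSpace I x →L[ℝ] ℂ),
      x.1 ∈ V ∧ (∀ l m, GenHolFormOn 𝒥 (A l m) V) ∧ ∃ hV : V ≤ E.cover j,
        ∀ (y : U) (hy : y.1 ∈ V) (X : TangentSpace I y.1) (v : E.Fiber y),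
          E.fiberEquiv j y (hV hy) (t y X v) =
            (Matrix.of fun l m => A l m y X).mulVec (E.fiberEquiv j y (hV hy) v)) :
    t ∈ E.holEndForms U := by
  intro i
  refine ⟨fun l m x => if h : x ∈ U ∧ x ∈ E.cover i then
    E.endComponent (t ⟨x, h.1⟩) i h.2 l m else 0,
    fun l m => GenHolFormOn.of_local fun x hx => ?_, fun x hi X v => ?_⟩
  · obtain ⟨V, j, A, hxV, hA, hV, he⟩ := h ⟨x, hx.1⟩
    -- Matrices of endomorphisms change by conjugation, `φ_ij A φ_ji`, whence the double sum.
    refine ⟨V ⊓ (E.cover i ⊓ E.cover j), fun y => ∑ a, ∑ b,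
      (E.transition i j y l a * E.transition j i y b m) • A a b y,
      ⟨hxV, hx.2, hV hxV⟩, GenHolFormOn.sum _ fun a _ => GenHolFormOn.sum _ fun b _ =>
        GenHolFormOn.mul (GenHolOn.mul ((E.genHolOn_transition i j l a).mono inf_le_right)
          ((E.genHolOn_transition j i b m).mono fun y hy => ⟨hy.2.2, hy.2.1⟩))
          ((hA a b).mono inf_le_left), ?_⟩
    intro y hy hyU
    refine (dif_pos hyU).trans (ContinuousLinearMap.ext fun X => ?_)
    rw [endComponent_apply, ← E.transition_mulVec_fiberEquiv hyU.2 (hV hy.1),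
      he ⟨y, hyU.1⟩ hy.1, ← E.transition_mulVec (hV hy.1) hyU.2]
    simp only [Matrix.mulVec, dotProduct, sum_apply, smul_apply, smul_eq_mul, Matrix.of_apply,
      Pi.single_apply, mul_ite, mul_one, mul_zero, Finset.sum_ite_eq',
      Finset.mem_univ, if_true, Finset.mul_sum]
    refine Finset.sum_congr rfl fun a _ => Finset.sum_congr rfl fun b _ => ?_
    ring
  · simp only [dif_pos (show x.1 ∈ U ∧ x.1 ∈ E.cover i from ⟨x.2, hi⟩)]
    exact (E.endComponent_mulVec _ i hi X v).symm

end GenHolBundle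

end Gluing

open CategoryTheory Opposite

/-! ### The Atiyah cocycle -/

section Cocycle

variable {W : Type} [NormedAddCommGroup W] [NormedSpace ℝ W]
  {H : Type*} [TopologicalSpace H] {I : ModelWithCorners ℝ W H}
  {M : Type*} [TopologicalSpace M] [ChartedSpace H M] [IsManifold I ∞ M]
  {𝒥 : GenComplexStructure I M} {r : ℕ} {V : M → Type*}
  [∀ x, AddCommGroup (V x)] [∀ x, Module ℝ (V x)] [∀ x, TopologicalSpace (V x)]
  [TopologicalSpace (TotalSpace (Fin r → ℂ) V)] [FiberBundle (Fin r → ℂ) V]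
  [VectorBundle ℝ (Fin r → ℂ) V] [ContMDiffVectorBundle ∞ (Fin r → ℂ) V I] {ι : Type*}
  (E : GenHolBundle 𝒥 r V ι)

theorem dFun_mul {f g : M → ℂ} {x : M} (hf : MDifferentiableAt I 𝓘(ℝ, ℂ) f x)
    (hg : MDifferentiableAt I 𝓘(ℝ, ℂ) g x) (X : TangentSpace I x) :
    dFun (fun y => f y * g y) x X = dFun f x X * g x + f x * dFun g x X := by
  have := DFunLike.congr_fun (hf.hasMFDerivAt.mul hg.hasMFDerivAt).mfderiv X
  refine this.trans ?_
  change f x * dFun g x X + g x * dFun f x X = _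
  ring

theorem dFun_sum {κ : Type} (s : Finset κ) {f : κ → M → ℂ} {x : M}
    (hf : ∀ k ∈ s, MDifferentiableAt I 𝓘(ℝ, ℂ) (f k) x) (X : TangentSpace I x) :
    dFun (fun y => ∑ k ∈ s, f k y) x X = ∑ k ∈ s, dFun (f k) x X := by
  let D : κ → TangentSpace I x →L[ℝ] ℂ := fun k => dFun (f k) x
  have h0 : ∀ k ∈ s, HasMFDerivAt I 𝓘(ℝ, ℂ) (f k) x (D k) := fun k hk => (hf k hk).hasMFDerivAt
  have h := (HasMFDerivAt.sum h0).mfderiv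
  have e : (∑ k ∈ s, f k) = fun y => ∑ k ∈ s, f k y := by
    ext y; simp
  rw [e] at h
  refine (DFunLike.congr_fun h X).trans ?_
  exact sum_apply s D X

theorem dFun_sum_mul {κ : Type} [Fintype κ] {f g : κ → M → ℂ} {x : M}
    (hf : ∀ k, MDifferentiableAt I 𝓘(ℝ, ℂ) (f k) x)
    (hg : ∀ k, MDifferentiableAt I 𝓘(ℝ, ℂ) (g k) x) (X : TangentSpace I x) :
    dFun (fun y => ∑ k, f k y * g k y) x X =
      ∑ k, dFun (f k) x X * g k x + ∑ k, f k x * dFun (g k) x X := by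
  have h : ∀ k, MDifferentiableAt I 𝓘(ℝ, ℂ) (fun y => f k y * g k y) x := fun k =>
    ((hf k).hasMFDerivAt.mul (hg k).hasMFDerivAt).mdifferentiableAt
  rw [dFun_sum _ fun k _ => h k, ← Finset.sum_add_distrib]
  exact Finset.sum_congr rfl fun k _ => dFun_mul (hf k) (hg k) X

namespace GenHolBundle

/-- Since the entries are generalized holomorphic, `d_+` of the transition matrix is its ordinary
differential and obeys the usual product rule. -/
theorem dPlusTransition_apply {i j : ι} {x : M} (hi : x ∈ E.cover i) (hj : x ∈ E.cover j)
    (X : TangentSpace I x) (l m : Fin r) :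
    E.dPlusTransition i j x X l m = dFun (fun y => E.transition i j y l m) x X := by
  change covectorPart (dPlus 𝒥 _ x) X = _
  rw [(E.genHolOn_transition i j l m).covectorPart_dPlus ⟨hi, hj⟩]

theorem dPlusTransition_add (i j : ι) (x : M) (X Y : TangentSpace I x) :
    E.dPlusTransition i j x (X + Y) = E.dPlusTransition i j x X + E.dPlusTransition i j x Y := by
  ext l m
  exact map_add (covectorPart (dPlus 𝒥 (fun y => E.transition i j y l m) x)) X Y

theorem dPlusTransition_smul (i j : ι) (x : M) (a : ℝ) (X : TangentSpace I x) :
    E.dPlusTransition i j x (a • X) = a • E.dPlusTransition i j x X := by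
  ext l m
  exact (covectorPart (dPlus 𝒥 (fun y => E.transition i j y l m) x)).map_smul a X

/-- The product rule for `φ_ik = φ_ij φ_jk`. -/
theorem dPlusTransition_mul {i j k : ι} {x : M} (hi : x ∈ E.cover i) (hj : x ∈ E.cover j)
    (hk : x ∈ E.cover k) (X : TangentSpace I x) :
    E.dPlusTransition i k x X = E.dPlusTransition i j x X * E.transition j k x +
      E.transition i j x * E.dPlusTransition j k x X := by
  ext l m
  have hn : ((E.cover i ⊓ E.cover j ⊓ E.cover k : Opens M) : Set M) ∈ nhds x :=
    (E.cover i ⊓ E.cover j ⊓ E.cover k).isOpen.mem_nhds ⟨⟨hi, hj⟩, hk⟩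
  have h : dFun (I := I) (fun y => E.transition i k y l m) x =
      dFun (fun y => ∑ a, E.transition i j y l a * E.transition j k y a m) x := by
    refine dFun_congr (Filter.eventuallyEq_of_mem hn fun y hy => ?_)
    rw [← E.transition_mul hy.1.1 hy.1.2 hy.2, Matrix.mul_apply]
  rw [E.dPlusTransition_apply hi hk, h, dFun_sum_mul
    (fun a => (E.genHolOn_transition i j l a).mdiff ⟨hi, hj⟩)
    (fun a => (E.genHolOn_transition j k a m).mdiff ⟨hj, hk⟩), Matrix.add_apply,
    Matrix.mul_apply, Matrix.mul_apply]
  simp only [E.dPlusTransition_apply hi hj, E.dPlusTransition_apply hj hk]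

/-- The endomorphism of `E_x` with matrix `B` in the `j`-th trivialization. -/
def endOfMatrix (j : ι) {x : M} (hj : x ∈ E.cover j) (B : Matrix (Fin r) (Fin r) ℂ) :
    Module.End ℂ (E.Fiber x) :=
  (E.fiberEquiv j x hj).symm.toLinearMap ∘ₗ B.mulVecLin ∘ₗ (E.fiberEquiv j x hj).toLinearMap

theorem endOfMatrix_apply {j : ι} {x : M} (hj : x ∈ E.cover j) (B : Matrix (Fin r) (Fin r) ℂ)
    (v : E.Fiber x) :
    E.endOfMatrix j hj B v = (E.fiberEquiv j x hj).symm (B.mulVec (E.fiberEquiv j x hj v)) :=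
  rfl

/-- Change of trivialization. -/
theorem endOfMatrix_eq {i j : ι} {x : M} (hi : x ∈ E.cover i) (hj : x ∈ E.cover j)
    (B : Matrix (Fin r) (Fin r) ℂ) :
    E.endOfMatrix i hi B =
      E.endOfMatrix j hj (E.transition j i x * B * E.transition i j x) := by
  refine LinearMap.ext fun v => ?_
  rw [endOfMatrix_apply, endOfMatrix_apply, ← Matrix.mulVec_mulVec,
    E.transition_mulVec_fiberEquiv hi hj, ← Matrix.mulVec_mulVec, E.transition_mulVec hj hi,
    LinearEquiv.symm_apply_apply]

/-- The Atiyah cocycle `φ_j⁻¹ ∘ (φ_ij⁻¹ d_+(φ_ij)) ∘ φ_j`. -/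
def atiyahForm (i j : ι) (x : (E.cover i ⊓ E.cover j : Opens M)) :
    TangentSpace I x.1 →ₗ[ℝ] Module.End ℂ (E.Fiber x) where
  toFun X := E.endOfMatrix j x.2.2 ((E.transition i j x)⁻¹ * E.dPlusTransition i j x X)
  map_add' X Y := by
    refine LinearMap.ext fun v => ?_
    rw [LinearMap.add_apply, endOfMatrix_apply, endOfMatrix_apply, endOfMatrix_apply,
      dPlusTransition_add, mul_add, Matrix.add_mulVec, map_add]
  map_smul' a X := by
    refine LinearMap.ext fun v => ?_
    rw [RingHom.id_apply, LinearMap.smul_apply, endOfMatrix_apply, endOfMatrix_apply,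
      dPlusTransition_smul, mul_smul_comm, Matrix.smul_mulVec, ← Complex.coe_smul,
      ← Complex.coe_smul, map_smul]

theorem atiyahForm_apply (i j : ι) (x : (E.cover i ⊓ E.cover j : Opens M))
    (X : TangentSpace I x.1) : E.atiyahForm i j x X =
      E.endOfMatrix j x.2.2 ((E.transition i j x)⁻¹ * E.dPlusTransition i j x X) := rfl

/-- The logarithmic derivative of a product: `φ_jk` conjugates the first term, which is what remains
of the noncommutativity. -/
theorem atiyahMatrix_cocycle {i j k : ι} {x : M} (hi : x ∈ E.cover i) (hj : x ∈ E.cover j)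
    (hk : x ∈ E.cover k) (X : TangentSpace I x) :
    (E.transition i k x)⁻¹ * E.dPlusTransition i k x X =
      E.transition k j x * ((E.transition i j x)⁻¹ * E.dPlusTransition i j x X) *
        E.transition j k x + (E.transition j k x)⁻¹ * E.dPlusTransition j k x X := by
  have h : E.transition k j x * (E.transition j i x * E.transition i j x) =
      E.transition k j x := by
    rw [E.transition_mul hj hi hj, E.transition_self hj, mul_one]
  rw [E.dPlusTransition_mul hi hj hk, E.transition_inv hi hk, E.transition_inv hi hj,
    E.transition_inv hj hk, ← E.transition_mul hk hj hi, mul_add]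
  -- The fourth occurrence is the one in the last summand of the right-hand side, where `φ_ji φ_ij =
  -- 1` has to be inserted.
  nth_rewrite 4 [← h]
  simp only [mul_assoc]

/-- The conjugation by `φ_jk` is exactly the change from the `j`-th to the `k`-th trivialization.
Read as endomorphisms of `E`, the logarithmic derivatives therefore add up; this is the role of
`φ_j` in the definition. -/
theorem atiyahForm_cocycle {i j k : ι} {x : M} (hi : x ∈ E.cover i) (hj : x ∈ E.cover j)
    (hk : x ∈ E.cover k) :
    E.atiyahForm i k ⟨x, ⟨hi, hk⟩⟩ =
      E.atiyahForm i j ⟨x, ⟨hi, hj⟩⟩ + E.atiyahForm j k ⟨x, ⟨hj, hk⟩⟩ := by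
  refine LinearMap.ext fun X => LinearMap.ext fun v => ?_
  rw [LinearMap.add_apply, LinearMap.add_apply, atiyahForm_apply, atiyahForm_apply,
    atiyahForm_apply, E.endOfMatrix_eq hj hk, endOfMatrix_apply, endOfMatrix_apply,
    endOfMatrix_apply, ← map_add, ← Matrix.add_mulVec, E.atiyahMatrix_cocycle hi hj hk]

variable [FiniteDimensional ℝ W] [I.Boundaryless]

/-- In the `j`-th trivialization the matrix is `φ_ji dφ_ij`, whose entries are sums of products of a
generalized holomorphic function and the differential of another one. -/
theorem atiyahForm_mem (i j : ι) : E.atiyahForm i j ∈ E.holEndForms (E.cover i ⊓ E.cover j) := by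
  refine E.mem_holEndForms_of_local fun x => ⟨E.cover i ⊓ E.cover j, j, fun l m y =>
    ∑ a, E.transition j i y l a • dFun (fun z => E.transition i j z a m) y, x.2, fun l m =>
    GenHolFormOn.sum _ fun a _ => GenHolFormOn.mul
      ((E.genHolOn_transition j i l a).mono fun y hy => ⟨hy.2, hy.1⟩)
      (E.genHolOn_transition i j a m).genHolFormOn_dFun, inf_le_right, fun y hy X v => ?_⟩
  rw [atiyahForm_apply, endOfMatrix_apply, LinearEquiv.apply_symm_apply,
    E.transition_inv hy.1 hy.2]
  congr 1
  ext l m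
  rw [Matrix.mul_apply]
  simp only [E.dPlusTransition_apply hy.1 hy.2, Matrix.of_apply, sum_apply, smul_apply,
    smul_eq_mul]

/-- The Atiyah cocycle. -/
def atiyahCocycle : Cech.Z1 E.cover E.endForms :=
  ⟨fun i j => (⟨E.atiyahForm i j, E.atiyahForm_mem i j⟩ :
      E.holEndForms (E.cover i ⊓ E.cover j)), by
    change Cech.d1 E.cover E.endForms _ = 0
    funext i j k
    refine Subtype.ext (funext fun x => ?_)
    change E.atiyahForm j k ⟨x.1, x.2.1.2, x.2.2⟩ - E.atiyahForm i k ⟨x.1, x.2.1.1, x.2.2⟩ +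
      E.atiyahForm i j ⟨x.1, x.2.1⟩ = 0
    rw [E.atiyahForm_cocycle x.2.1.1 x.2.1.2 x.2.2]
    abel⟩

theorem isAtiyahCocycle_atiyahCocycle : E.IsAtiyahCocycle E.atiyahCocycle :=
  fun _ _ _ _ _ => rfl

end GenHolBundle

end Cocycle

/-! ### Flat derivatives in the trivializations -/

section Connections

variable {W : Type} [NormedAddCommGroup W] [NormedSpace ℝ W]
  {H : Type*} [TopologicalSpace H] {I : ModelWithCorners ℝ W H}
  {M : Type*} [TopologicalSpace M] [ChartedSpace H M] [IsManifold I ∞ M]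
  {𝒥 : GenComplexStructure I M} {r : ℕ} {V : M → Type*}
  [∀ x, AddCommGroup (V x)] [∀ x, Module ℝ (V x)] [∀ x, TopologicalSpace (V x)]
  [TopologicalSpace (TotalSpace (Fin r → ℂ) V)] [FiberBundle (Fin r → ℂ) V]
  [VectorBundle ℝ (Fin r → ℂ) V] [ContMDiffVectorBundle ∞ (Fin r → ℂ) V I] {ι : Type*}
  (E : GenHolBundle 𝒥 r V ι)

namespace GenHolBundle

theorem fiberEquiv_eq_sum_component {U : Opens M} (s : E.holSections U) {i j : ι} {x : M}
    (hx : x ∈ U) (hi : x ∈ E.cover i) (hj : x ∈ E.cover j) (l : Fin r) :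
    E.component s.1 i l x = ∑ m, E.transition i j x l m * E.component s.1 j m x := by
  rw [E.component_apply _ _ hx hi, ← E.transition_mulVec_fiberEquiv hi hj]
  simp only [E.component_apply _ _ hx hj]
  rfl

/-- The derivative of a section in the `i`-th trivialization, `φ_i⁻¹ ∘ d ∘ φ_i`. -/
def flatDeriv (i : ι) {U : Opens M} (s : E.holSections U) {x : M} (hi : x ∈ E.cover i) :
    TangentSpace I x →ₗ[ℝ] E.Fiber x where
  toFun X := (E.fiberEquiv i x hi).symm fun l => dFun (E.component s.1 i l) x X
  map_add' X Y := by
    rw [← map_add]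
    congr 1
    funext l
    exact map_add (dFun (E.component s.1 i l) x) X Y
  map_smul' a X := by
    rw [RingHom.id_apply, ← Complex.coe_smul, ← map_smul]
    congr 1
    funext l
    exact (dFun (E.component s.1 i l) x).map_smul a X

theorem flatDeriv_apply {i : ι} {U : Opens M} (s : E.holSections U) {x : M}
    (hi : x ∈ E.cover i) (X : TangentSpace I x) :
    E.flatDeriv i s hi X =
      (E.fiberEquiv i x hi).symm fun l => dFun (E.component s.1 i l) x X := rfl

theorem mdifferentiableAt_component {U : Opens M} (s : E.holSections U) {i : ι} {x : M}
    (hx : x ∈ U) (hi : x ∈ E.cover i) (l : Fin r) :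
    MDifferentiableAt I 𝓘(ℝ, ℂ) (E.component s.1 i l) x :=
  (E.genHolOn_component s i l).mdiff ⟨hx, hi⟩

/-- Components are extended by zero and can be discontinuous at the edge of their domain, so they
are compared only near `x`. -/
theorem dFun_component_congr {U U' : Opens M} {s : E.holSections U}
    {i : ι} {x : M} (hx : x ∈ U) (hx' : x ∈ U') (hi : x ∈ E.cover i) (f : M → ℂ) (l : Fin r)
    (h : ∀ y (_ : y ∈ U) (_ : y ∈ U') (_ : y ∈ E.cover i), E.component s.1 i l y = f y) :
    dFun (I := I) (E.component s.1 i l) x = dFun f x :=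
  dFun_congr (Filter.eventuallyEq_of_mem ((U ⊓ U' ⊓ E.cover i).isOpen.mem_nhds ⟨⟨hx, hx'⟩, hi⟩)
    fun y hy => h y hy.1.1 hy.1.2 hy.2)

theorem flatDeriv_congr {U U' : Opens M} {s : E.holSections U} {s' : E.holSections U'}
    {i : ι} {x : M} (hx : x ∈ U) (hx' : x ∈ U') (hi : x ∈ E.cover i)
    (h : ∀ y (hy : y ∈ U) (hy' : y ∈ U'), s.1 ⟨y, hy⟩ = s'.1 ⟨y, hy'⟩) :
    E.flatDeriv i s hi = E.flatDeriv i s' hi := by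
  refine LinearMap.ext fun X => ?_
  rw [flatDeriv_apply, flatDeriv_apply]
  congr 1
  funext l
  rw [E.dFun_component_congr hx hx' hi (E.component s'.1 i l) l
    fun y hy hy' hyi => by
      rw [E.component_apply _ _ hy hyi, E.component_apply _ _ hy' hyi, h y hy hy']]

theorem flatDeriv_add (i : ι) {U : Opens M} (s t : E.holSections U) {x : M} (hx : x ∈ U)
    (hi : x ∈ E.cover i) :
    E.flatDeriv i (s + t) hi = E.flatDeriv i s hi + E.flatDeriv i t hi := by
  refine LinearMap.ext fun X => ?_
  rw [LinearMap.add_apply, flatDeriv_apply, flatDeriv_apply, flatDeriv_apply, ← map_add]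
  congr 1
  funext l
  have h : dFun (I := I) (E.component (s + t).1 i l) x =
      dFun (E.component s.1 i l) x + dFun (E.component t.1 i l) x := by
    rw [E.dFun_component_congr hx hx hi
      (fun y => E.component s.1 i l y + E.component t.1 i l y) l fun y hy _ hyi => by
        rw [E.component_apply _ _ hy hyi, E.component_apply _ _ hy hyi,
          E.component_apply _ _ hy hyi]
        exact congrFun (map_add (E.fiberEquiv i y hyi) _ _) l]
    exact mfderiv_add (E.mdifferentiableAt_component s hx hi l)
      (E.mdifferentiableAt_component t hx hi l)
  rw [h]
  rfl

/-- The Leibniz rule. -/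
theorem flatDeriv_mulSection (i : ι) {U : Opens M} {f : M → ℂ} (hf : GenHolOn 𝒥 f U)
    (s : E.holSections U) {x : M} (hx : x ∈ U) (hi : x ∈ E.cover i) (X : TangentSpace I x) :
    E.flatDeriv i (E.mulSection hf s) hi X =
      dFun f x X • s.1 ⟨x, hx⟩ + f x • E.flatDeriv i s hi X := by
  apply (E.fiberEquiv i x hi).injective
  rw [map_add, map_smul, map_smul, flatDeriv_apply, flatDeriv_apply,
    LinearEquiv.apply_symm_apply, LinearEquiv.apply_symm_apply]
  funext l
  rw [E.dFun_component_congr hx hx hi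
      (fun y => f y * E.component s.1 i l y) l fun y hy _ hyi => by
        rw [E.component_apply _ _ hy hyi, E.component_apply _ _ hy hyi]
        exact congrFun (map_smul (E.fiberEquiv i y hyi) (f y) _) l,
    dFun_mul (hf.mdiff hx) (E.mdifferentiableAt_component s hx hi l),
    E.component_apply _ _ hx hi]
  rfl

theorem flatDeriv_smul (i : ι) {U : Opens M} (c : ℂ) (s : E.holSections U) {x : M} (hx : x ∈ U)
    (hi : x ∈ E.cover i) :
    E.flatDeriv i (c • s) hi = c • E.flatDeriv i s hi := by
  refine LinearMap.ext fun X => ?_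
  -- A constant is a generalized holomorphic function with zero differential, so homogeneity is a
  -- case of the Leibniz rule.
  have h := E.flatDeriv_mulSection i (GenHolOn.const (𝒥 := 𝒥) c U) s hx hi X
  have h0 : dFun (I := I) (fun _ : M => c) x = 0 := mfderiv_const
  rw [h0] at h
  refine h.trans ?_
  rw [zero_apply, zero_smul, zero_add]
  rfl

/-- The flat connections of two trivializations differ by the Atiyah cocycle. -/
theorem flatDeriv_eq {i j : ι} {U : Opens M} (s : E.holSections U) {x : M} (hx : x ∈ U)
    (hi : x ∈ E.cover i) (hj : x ∈ E.cover j) (X : TangentSpace I x) :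
    E.flatDeriv i s hi X =
      E.flatDeriv j s hj X + E.atiyahForm i j ⟨x, ⟨hi, hj⟩⟩ X (s.1 ⟨x, hx⟩) := by
  -- Differentiate `s_i = φ_ij s_j`. After applying `φ_i⁻¹`, the term `φ_ij ds_j` gives the flat
  -- derivative for `j` and the term `dφ_ij s_j` gives the Atiyah cocycle.
  have h : (fun l => dFun (E.component s.1 i l) x X) =
      (E.dPlusTransition i j x X).mulVec (E.fiberEquiv j x hj (s.1 ⟨x, hx⟩)) +
        (E.transition i j x).mulVec fun l => dFun (E.component s.1 j l) x X := by
    funext l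
    rw [dFun_congr (Filter.eventuallyEq_of_mem
        ((U ⊓ E.cover i ⊓ E.cover j).isOpen.mem_nhds ⟨⟨hx, hi⟩, hj⟩)
        fun y hy => E.fiberEquiv_eq_sum_component s hy.1.1 hy.1.2 hy.2 l),
      dFun_sum_mul (fun m => (E.genHolOn_transition i j l m).mdiff ⟨hi, hj⟩)
        fun m => E.mdifferentiableAt_component s hx hj m]
    simp only [← E.dPlusTransition_apply hi hj, E.component_apply _ _ hx hj]
    rfl
  rw [flatDeriv_apply, flatDeriv_apply, h, map_add, E.transition_mulVec hi hj,
    LinearEquiv.symm_apply_apply, add_comm, atiyahForm_apply, endOfMatrix_apply]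
  congr 1
  rw [E.transition_inv hi hj, ← Matrix.mulVec_mulVec, E.transition_mulVec hj hi,
    LinearEquiv.symm_apply_apply]

/-- The section with constant components in the `i`-th trivialization. -/
def constSection (i : ι) (w : Fin r → ℂ) : E.holSections (E.cover i) :=
  ⟨fun x => (E.fiberEquiv i x x.2).symm w, E.mem_holSections_of_local fun x =>
    ⟨E.cover i, i, fun l _ => w l, x.2, fun l => GenHolOn.const (w l) _, le_rfl,
      fun y hy l => by rw [LinearEquiv.apply_symm_apply]⟩⟩

theorem constSection_apply {i : ι} (w : Fin r → ℂ) (x : E.cover i) :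
    (E.constSection i w).1 x = (E.fiberEquiv i x x.2).symm w := rfl

/-- Restriction of sections. -/
def restrict {U U' : Opens M} (h : U' ≤ U) (s : E.holSections U) : E.holSections U' :=
  show E.sections.obj (op U') from (E.sections.map (homOfLE h).op).hom s

theorem restrict_apply {U U' : Opens M} (h : U' ≤ U) (s : E.holSections U) (x : U') :
    (E.restrict h s).1 x = s.1 ⟨x.1, h x.2⟩ := rfl

/-! ### The connection forms of a generalized holomorphic connection -/

namespace Connection

variable {E} (D : E.Connection)

/-- The operator on sections over `U`. -/
def on (U : Opens M) : E.holSections U →ₗ[ℂ] E.holForms U := (D.D.app (op U)).hom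

theorem on_restrict {U U' : Opens M} (h : U' ≤ U) (s : E.holSections U) (x : U') :
    (D.on U' (E.restrict h s)).1 x = (D.on U s).1 ⟨x.1, h x.2⟩ := by
  have h1 := congrArg ModuleCat.Hom.hom (D.D.naturality (homOfLE h).op)
  have h2 := LinearMap.congr_fun h1 s
  exact congrFun (congrArg Subtype.val h2) x

theorem on_mulSection {U : Opens M} {f : M → ℂ} (hf : GenHolOn 𝒥 f U) (s : E.holSections U)
    (x : U) (X : TangentSpace I x.1) :
    (D.on U (E.mulSection hf s)).1 x X = dFun f x X • s.1 x + f x • (D.on U s).1 x X := by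
  rw [← hf.covectorPart_dPlus x.2]
  exact D.leibniz U f hf s x X

/-- The connection form `D - φ_i⁻¹ ∘ d ∘ φ_i`. -/
def form (i : ι) (x : E.cover i) : TangentSpace I x.1 →ₗ[ℝ] Module.End ℂ (E.Fiber x) where
  -- `D` acts on sections, not on fibre vectors, so the constant frame is used. The flat derivative
  -- kills it, and `D` of the `m`-th frame section is the `m`-th column.
  toFun X := E.endOfMatrix i x.2 (Matrix.of fun l m => E.fiberEquiv i x x.2
    ((D.on _ (E.constSection i (Pi.single m 1))).1 x X) l)
  map_add' X Y := by
    refine LinearMap.ext fun v => ?_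
    rw [LinearMap.add_apply, endOfMatrix_apply, endOfMatrix_apply, endOfMatrix_apply, ← map_add,
      ← Matrix.add_mulVec]
    congr 2
    ext l m
    simp
  map_smul' a X := by
    refine LinearMap.ext fun v => ?_
    rw [RingHom.id_apply, LinearMap.smul_apply, endOfMatrix_apply, endOfMatrix_apply,
      ← Complex.coe_smul, ← map_smul, ← Matrix.smul_mulVec]
    congr 2
    ext l m
    simp only [Matrix.of_apply, Matrix.smul_apply, map_smul]
    rw [← Complex.coe_smul, map_smul]
    rfl

theorem form_apply (i : ι) (x : E.cover i) (X : TangentSpace I x.1) (v : E.Fiber x) :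
    D.form i x X v = ∑ m, E.fiberEquiv i x x.2 v m •
      (D.on _ (E.constSection i (Pi.single m 1))).1 x X := by
  apply (E.fiberEquiv i x x.2).injective
  change E.fiberEquiv i x x.2 (E.endOfMatrix i x.2 _ v) = _
  rw [endOfMatrix_apply, LinearEquiv.apply_symm_apply, map_sum]
  funext l
  simp only [Matrix.mulVec, dotProduct, Matrix.of_apply, map_smul, Finset.sum_apply,
    Pi.smul_apply, smul_eq_mul, mul_comm]

theorem form_mem (i : ι) [FiniteDimensional ℝ W] : D.form i ∈ E.holEndForms (E.cover i) := by
  choose θ hθ hθ' using fun m => (D.on _ (E.constSection i (Pi.single m 1))).2 i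
  refine E.mem_holEndForms_of_local fun x => ⟨E.cover i, i, fun l m => θ m l, x.2,
    fun l m => (hθ m l).mono fun y hy => ⟨hy, hy⟩, le_rfl, fun y hy X v => ?_⟩
  change E.fiberEquiv i y hy (E.endOfMatrix i hy _ v) = _
  rw [endOfMatrix_apply, LinearEquiv.apply_symm_apply]
  congr 1
  ext l m
  exact hθ' m y hy X l

/-- In a trivialization, `D` is the sum of the flat connection and of the connection form. -/
theorem on_apply {i : ι} {U : Opens M} (hU : U ≤ E.cover i) (s : E.holSections U) (x : U)
    (X : TangentSpace I x.1) :
    (D.on U s).1 x X = E.flatDeriv i s (hU x.2) X + D.form i ⟨x.1, hU x.2⟩ X (s.1 x) := by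
  have hf : ∀ m, GenHolOn 𝒥 (E.component s.1 i m) U := fun m =>
    (E.genHolOn_component s i m).mono fun y hy => ⟨hy, hU hy⟩
  -- Expand `s` in the constant frame with generalized holomorphic coefficients. The Leibniz rule
  -- then splits `D s` into the derivatives of the coefficients and the values of `D` on the frame.
  have hs : s = ∑ m, E.mulSection (hf m) (E.restrict hU (E.constSection i (Pi.single m 1))) := by
    refine Subtype.ext (funext fun y => ?_)
    rw [AddSubmonoidClass.coe_finsetSum, Finset.sum_apply]
    apply (E.fiberEquiv i y (hU y.2)).injective
    rw [map_sum]
    have : ∀ m, E.fiberEquiv i y (hU y.2) ((E.mulSection (hf m)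
        (E.restrict hU (E.constSection i (Pi.single m 1)))).1 y) =
        E.component s.1 i m y • (Pi.single m 1 : Fin r → ℂ) := by
      intro m
      refine (map_smul (E.fiberEquiv i y (hU y.2)) _ _).trans ?_
      rw [restrict_apply, constSection_apply, LinearEquiv.apply_symm_apply]
    rw [Finset.sum_congr rfl fun m _ => this m]
    funext l
    simp [Finset.sum_apply, Pi.single_apply, E.component_apply s.1 l y.2 (hU y.2)]
  have h1 : (D.on U s).1 x X = ∑ m, (dFun (E.component s.1 i m) x X •
      (E.fiberEquiv i x (hU x.2)).symm (Pi.single m 1) + E.component s.1 i m x •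
        (D.on _ (E.constSection i (Pi.single m 1))).1 ⟨x.1, hU x.2⟩ X) := by
    conv_lhs => rw [hs]
    rw [map_sum, AddSubmonoidClass.coe_finsetSum, Finset.sum_apply, LinearMap.sum_apply]
    refine Finset.sum_congr rfl fun m _ => ?_
    rw [D.on_mulSection, on_restrict]
    rfl
  rw [h1, Finset.sum_add_distrib, form_apply]
  congr 1
  · rw [flatDeriv_apply]
    simp only [← map_smul, ← map_sum]
    congr 1
    funext l
    simp [Finset.sum_apply, Pi.single_apply]
  · refine Finset.sum_congr rfl fun m _ => ?_
    rw [E.component_apply s.1 m x.2 (hU x.2)]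

/-- Any fibre vector is the value of a local generalized holomorphic section, constant in the `j`-th
trivialization. Evaluating `D` on it in both trivializations turns the difference of flat
derivatives into a difference of connection forms. -/
theorem form_sub_form (i j : ι) (x : (E.cover i ⊓ E.cover j : Opens M)) :
    D.form j ⟨x.1, x.2.2⟩ - D.form i ⟨x.1, x.2.1⟩ = E.atiyahForm i j x := by
  refine LinearMap.ext fun X => LinearMap.ext fun v => ?_
  let s := E.restrict (inf_le_right : E.cover i ⊓ E.cover j ≤ E.cover j)
    (E.constSection j (E.fiberEquiv j x x.2.2 v))
  have hs : s.1 x = v := (E.fiberEquiv j x x.2.2).symm_apply_apply v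
  have h1 := D.on_apply inf_le_left s x X
  rw [D.on_apply inf_le_right s x X, E.flatDeriv_eq s x.2 x.2.1 x.2.2 X, add_assoc,
    add_right_inj, hs] at h1
  rw [LinearMap.sub_apply, LinearMap.sub_apply, sub_eq_iff_eq_add]
  exact h1

end Connection

end GenHolBundle

end Connections

/-! ### Connections from cochains, and the Atiyah class -/

section Existence

variable {W : Type} [NormedAddCommGroup W] [NormedSpace ℝ W]
  {H : Type*} [TopologicalSpace H] {I : ModelWithCorners ℝ W H}
  {M : Type*} [TopologicalSpace M] [ChartedSpace H M] [IsManifold I ∞ M]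
  {𝒥 : GenComplexStructure I M} {r : ℕ} {V : M → Type*}
  [∀ x, AddCommGroup (V x)] [∀ x, Module ℝ (V x)] [∀ x, TopologicalSpace (V x)]
  [TopologicalSpace (TotalSpace (Fin r → ℂ) V)] [FiberBundle (Fin r → ℂ) V]
  [VectorBundle ℝ (Fin r → ℂ) V] [ContMDiffVectorBundle ∞ (Fin r → ℂ) V I] {ι : Type*}
  (E : GenHolBundle 𝒥 r V ι)

namespace GenHolBundle

section OfCochain

variable {κ : Type*} {Vc : κ → Opens M} {τ : κ → ι} (hτ : ∀ k, Vc k ≤ E.cover (τ k))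
  (β : ∀ k, E.holEndForms (Vc k))

/-- The local connection `φ⁻¹ ∘ d ∘ φ + β_k` on `V_k`. -/
def localConn (k : κ) {U : Opens M} (s : E.holSections U) {x : M} (hx : x ∈ U) (hk : x ∈ Vc k) :
    TangentSpace I x →ₗ[ℝ] E.Fiber x :=
  E.flatDeriv (τ k) s (hτ k hk) +
    ((LinearMap.applyₗ (s.1 ⟨x, hx⟩)).restrictScalars ℝ).comp ((β k).1 ⟨x, hk⟩)

theorem localConn_apply (k : κ) {U : Opens M} (s : E.holSections U) {x : M} (hx : x ∈ U)
    (hk : x ∈ Vc k) (X : TangentSpace I x) :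
    E.localConn hτ β k s hx hk X =
      E.flatDeriv (τ k) s (hτ k hk) X + (β k).1 ⟨x, hk⟩ X (s.1 ⟨x, hx⟩) := rfl

/-- The flat derivatives differ by the Atiyah cocycle, which is precisely the opposite of the change
from `β k` to `β l`. -/
theorem localConn_eq (hβ : ∀ k l x (hk : x ∈ Vc k) (hl : x ∈ Vc l),
      (β l).1 ⟨x, hl⟩ - (β k).1 ⟨x, hk⟩ =
        E.atiyahForm (τ k) (τ l) ⟨x, ⟨hτ k hk, hτ l hl⟩⟩)
    (k l : κ) {U : Opens M} (s : E.holSections U) {x : M} (hx : x ∈ U)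
    (hk : x ∈ Vc k) (hl : x ∈ Vc l) :
    E.localConn hτ β k s hx hk = E.localConn hτ β l s hx hl := by
  refine LinearMap.ext fun X => ?_
  rw [localConn_apply, localConn_apply, E.flatDeriv_eq s hx (hτ k hk) (hτ l hl), ← hβ k l x hk hl,
    LinearMap.sub_apply, LinearMap.sub_apply, add_assoc, sub_add_cancel]

variable [FiniteDimensional ℝ W] [I.Boundaryless]

/-- A cochain on a refinement of the cover whose coboundary is the Atiyah cocycle defines a
connection. -/
theorem nonempty_connection (hcov : ∀ x, ∃ k, x ∈ Vc k)
    (hβ : ∀ k l x (hk : x ∈ Vc k) (hl : x ∈ Vc l), (β l).1 ⟨x, hl⟩ - (β k).1 ⟨x, hk⟩ =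
      E.atiyahForm (τ k) (τ l) ⟨x, ⟨hτ k hk, hτ l hl⟩⟩) :
    Nonempty E.Connection := by
  -- At each point the operator uses an arbitrary chart index `k₀`, with no regularity in the point.
  -- Since the local connections agree on overlaps, near `x` the index may be frozen to `k₀ x`.
  choose k₀ hk₀ using hcov
  have hmem : ∀ (U : Opens M) (s : E.holSections U),
      (fun x : U => E.localConn hτ β (k₀ x) s x.2 (hk₀ x)) ∈ E.holForms U := by
    intro U s
    refine E.mem_holForms_of_local fun x => ?_
    obtain ⟨A, hA, hA'⟩ := (β (k₀ x)).2 (τ (k₀ x))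
    have hV : U ⊓ Vc (k₀ x) ≤ E.cover (τ (k₀ x)) := fun y hy => hτ _ hy.2
    have hs : ∀ l, GenHolOn 𝒥 (E.component s.1 (τ (k₀ x)) l) (U ⊓ Vc (k₀ x) : Opens M) :=
      fun l => (E.genHolOn_component s _ l).mono fun y hy => ⟨hy.1, hV hy⟩
    refine ⟨U ⊓ Vc (k₀ x), τ (k₀ x), fun l y => (1 : ℂ) • dFun (E.component s.1 (τ (k₀ x)) l) y +
      (1 : ℂ) • ∑ m, E.component s.1 (τ (k₀ x)) m y • A l m y, ⟨x.2, hk₀ x⟩,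
      fun l => (hs l).genHolFormOn_dFun.lin 1 1 (GenHolFormOn.sum _ fun m _ =>
        GenHolFormOn.mul (hs m) ((hA l m).mono fun y hy => ⟨hy.2, hV hy⟩)), hV,
      fun y hy X l => ?_⟩
    -- Passage from the index chosen at `y` to the fixed index chosen at `x`.
    rw [E.localConn_eq hτ β hβ (k₀ y) (k₀ x) s y.2 (hk₀ y) hy.2, localConn_apply, map_add,
      flatDeriv_apply, LinearEquiv.apply_symm_apply, hA' ⟨y.1, hy.2⟩ (hV hy)]
    simp only [one_smul, Pi.add_apply, Matrix.mulVec, dotProduct, Matrix.of_apply, add_apply, sum_apply,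
      smul_apply, smul_eq_mul, E.component_apply s.1 _ y.2 (hV hy), mul_comm]
  let D (U : Opens M) : E.holSections U →ₗ[ℂ] E.holForms U :=
    { toFun := fun s => ⟨_, hmem U s⟩
      map_add' := fun s t => Subtype.ext <| funext fun x => LinearMap.ext fun X => by
        change E.localConn hτ β (k₀ x) (s + t) x.2 (hk₀ x) X =
          E.localConn hτ β (k₀ x) s x.2 (hk₀ x) X + E.localConn hτ β (k₀ x) t x.2 (hk₀ x) X
        rw [localConn_apply, localConn_apply, localConn_apply, E.flatDeriv_add _ s t x.2]
        change _ + _ + (β (k₀ x)).1 ⟨x, _⟩ X (s.1 x + t.1 x) = _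
        rw [map_add]
        exact add_add_add_comm _ _ _ _
      map_smul' := fun c s => Subtype.ext <| funext fun x => LinearMap.ext fun X => by
        change E.localConn hτ β (k₀ x) (c • s) x.2 (hk₀ x) X =
          c • E.localConn hτ β (k₀ x) s x.2 (hk₀ x) X
        rw [localConn_apply, localConn_apply, E.flatDeriv_smul _ c s x.2]
        change _ + (β (k₀ x)).1 ⟨x, _⟩ X (c • s.1 x) = _
        rw [map_smul, smul_add]
        rfl }
  refine ⟨⟨{ app := fun U => ModuleCat.ofHom (D U.unop), naturality := ?_ }, ?_⟩⟩
  · intro U U' h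
    refine ModuleCat.hom_ext (LinearMap.ext fun s => Subtype.ext (funext fun x =>
      LinearMap.ext fun X => ?_))
    let s' : E.holSections U.unop := s
    have hx : x.1 ∈ U.unop := leOfHom h.unop x.2
    change E.localConn hτ β (k₀ x) (E.restrict (leOfHom h.unop) s') x.2 (hk₀ x) X =
      E.localConn hτ β (k₀ x) s' hx (hk₀ x) X
    rw [localConn_apply, localConn_apply,
      E.flatDeriv_congr (s' := s') x.2 hx _ fun y hy hy' => rfl]
    rfl
  · intro U f hf s x X
    change E.localConn hτ β (k₀ x) (E.mulSection hf s) x.2 (hk₀ x) X = _ • s.1 x +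
      f x • E.localConn hτ β (k₀ x) s x.2 (hk₀ x) X
    rw [localConn_apply, localConn_apply, E.flatDeriv_mulSection _ hf s x.2,
      hf.covectorPart_dPlus x.2]
    change _ + _ + (β (k₀ x)).1 ⟨x, _⟩ X (f x • s.1 x) = _
    rw [map_smul, smul_add, add_assoc]

end OfCochain

variable [FiniteDimensional ℝ W] [I.Boundaryless]

/-- The connection forms are a cochain of the original cover with coboundary the Atiyah cocycle; no
refinement is needed. -/
theorem mk_atiyahCocycle_eq_zero (D : E.Connection) :
    (Submodule.Quotient.mk E.atiyahCocycle : Cech.H1 E.cover E.endForms) = 0 := by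
  rw [Submodule.Quotient.mk_eq_zero]
  refine ⟨fun i => (⟨D.form i, D.form_mem i⟩ : E.holEndForms (E.cover i)), ?_⟩
  funext i j
  exact Subtype.ext (funext fun x => D.form_sub_form i j x)

/-- If the Atiyah class vanishes on a refinement of the cover, then there is a connection. -/
theorem nonempty_connection_of_refineZ1 {κ : Type*} {Vc : κ → Opens M} {τ : κ → ι}
    (hτ : ∀ k, Vc k ≤ E.cover (τ k)) (hcov : ∀ x, ∃ k, x ∈ Vc k)
    (h : Cech.refineZ1 τ hτ E.atiyahCocycle ∈ Cech.B1 Vc E.endForms) :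
    Nonempty E.Connection := by
  obtain ⟨β, hβ⟩ := h
  refine E.nonempty_connection hτ (fun k => (show E.holEndForms (Vc k) from β k)) hcov
    fun k l x hk hl => ?_
  have h1 : Cech.d0 Vc E.endForms β k l =
    Cech.res E.endForms (inf_le_inf (hτ k) (hτ l)) (E.atiyahCocycle.1 (τ k) (τ l)) :=
    congrFun (congrFun hβ k) l
  exact congrFun (congrArg Subtype.val h1) ⟨x, ⟨hk, hl⟩⟩

end GenHolBundle

/-! ### Vanishing in the direct limit over covers -/

namespace Cech

variable {X : Type*} [TopologicalSpace X]

/-- Pointwise intersection gives common refinements. With functoriality of refinement, this is what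
allows vanishing in the limit to be detected at a finite stage. -/
instance : IsDirectedOrder (PointCover X) where
  directed 𝒰 𝒱 := ⟨⟨fun x => 𝒰.set x ⊓ 𝒱.set x, fun x => ⟨𝒰.mem x, 𝒱.mem x⟩⟩,
    fun _ => inf_le_left, fun _ => inf_le_right⟩

theorem refineH1_mk {ι κ : Type*} {U : ι → Opens X} {F : (Opens X)ᵒᵖ ⥤ ModuleCat ℂ}
    {U' : κ → Opens X} (τ : κ → ι) (h : ∀ k, U' k ≤ U (τ k)) (c : Z1 U F) :
    refineH1 τ h (Submodule.Quotient.mk c : H1 U F) = Submodule.Quotient.mk (refineZ1 τ h c) :=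
  rfl

theorem refineZ1_refineZ1 {ι κ κ' : Type*} {U : ι → Opens X} {F : (Opens X)ᵒᵖ ⥤ ModuleCat ℂ}
    {U' : κ → Opens X} {U'' : κ' → Opens X} (τ : κ → ι) (h : ∀ k, U' k ≤ U (τ k))
    (σ : κ' → κ) (h' : ∀ k, U'' k ≤ U' (σ k)) (c : Z1 U F) :
    refineZ1 σ h' (refineZ1 τ h c) =
      refineZ1 (τ ∘ σ) (fun k => (h' k).trans (h (σ k))) c := by
  refine Subtype.ext (funext fun i => funext fun j => ?_)
  exact res_res _ _ _

instance (F : (Opens X)ᵒᵖ ⥤ ModuleCat ℂ) : DirectedSystem (fun 𝒰 : PointCover X => H1 𝒰.set F)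
    (fun _ _ h => refineH1 id h) where
  map_self 𝒰 c := by
    obtain ⟨c, rfl⟩ := Submodule.Quotient.mk_surjective _ c
    rw [refineH1_mk]
    congr 1
    refine Subtype.ext (funext fun i => funext fun j => ?_)
    exact LinearMap.congr_fun (congrArg ModuleCat.Hom.hom (F.map_id _)) (c.1 i j)
  map_map 𝒰 𝒱 𝒲 h h' c := by
    obtain ⟨c, rfl⟩ := Submodule.Quotient.mk_surjective _ c
    rw [refineH1_mk, refineH1_mk, refineH1_mk, refineZ1_refineZ1]
    rfl

/-- A cocycle whose class in the direct limit vanishes is a coboundary on some refinement. -/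
theorem exists_refineZ1_mem {ι : Type*} {U : ι → Opens X} (hU : ∀ x, ∃ i, x ∈ U i)
    {F : (Opens X)ᵒᵖ ⥤ ModuleCat ℂ} (c : Z1 U F)
    (hc : toH1Lim U hU F (Submodule.Quotient.mk c) = 0) :
    ∃ (𝒱 : PointCover X) (τ : X → ι) (h : ∀ x, 𝒱.set x ≤ U (τ x)),
      refineZ1 τ h c ∈ B1 𝒱.set F := by
  classical
  -- The class vanishes already on some `𝒱` that refines the cover indexed by points. The composite
  -- of the two refinement maps, from the given cover to that one and on to `𝒱`, supplies `τ`.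
  obtain ⟨𝒱, h, h0⟩ := Module.DirectLimit.of.zero_exact hc
  rw [refineH1_mk, refineH1_mk, Submodule.Quotient.mk_eq_zero, refineZ1_refineZ1] at h0
  exact ⟨𝒱, _, _, h0⟩

end Cech

end Existence

end GenCplx

end

/-- A generalized holomorphic vector bundle `E`, with trivializations `φ_i` over an open cover
`U_i`, admits a generalized holomorphic connection if and only if its Atiyah class vanishes, in
the Čech cohomology of the cover and in the Čech cohomology of `M`. -/
theorem mainTheorem1 {n r : ℕ} {M : Type*} [TopologicalSpace M] [T2Space M]
    [SecondCountableTopology M] [ChartedSpace (EuclideanSpace ℝ (Fin n)) M]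
    [IsManifold (𝓡 n) ∞ M] (𝒥 : GenCplx.GenComplexStructure (𝓡 n) M)
    (V : M → Type*) [∀ x, AddCommGroup (V x)] [∀ x, Module ℝ (V x)]
    [∀ x, TopologicalSpace (V x)] [TopologicalSpace (TotalSpace (Fin r → ℂ) V)]
    [FiberBundle (Fin r → ℂ) V] [VectorBundle ℝ (Fin r → ℂ) V]
    [ContMDiffVectorBundle ∞ (Fin r → ℂ) V (𝓡 n)] {ι : Type*}
    (E : GenCplx.GenHolBundle 𝒥 r V ι) :
    ∃ c : GenCplx.Cech.Z1 E.cover E.endForms, E.IsAtiyahCocycle c ∧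
      (Nonempty E.Connection ↔
        (Submodule.Quotient.mk c : GenCplx.Cech.H1 E.cover E.endForms) = 0) ∧
      (Nonempty E.Connection ↔
        GenCplx.Cech.toH1Lim E.cover E.covers E.endForms (Submodule.Quotient.mk c) = 0) := by
  -- Both equivalences follow from the cycle `hf`, `hl`, `hb`; injectivity of the map from `H^1` of
  -- the cover to the limit is not used.
  have hf : Nonempty E.Connection →
      (Submodule.Quotient.mk E.atiyahCocycle : GenCplx.Cech.H1 E.cover E.endForms) = 0 :=
    fun ⟨D⟩ => E.mk_atiyahCocycle_eq_zero D
  have hb : GenCplx.Cech.toH1Lim E.cover E.covers E.endForms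
      (Submodule.Quotient.mk E.atiyahCocycle) = 0 → Nonempty E.Connection := by
    intro h
    obtain ⟨𝒱, τ, hτ, hc⟩ := GenCplx.Cech.exists_refineZ1_mem E.covers _ h
    exact E.nonempty_connection_of_refineZ1 hτ (fun x => ⟨x, 𝒱.mem x⟩) hc
  have hl : (Submodule.Quotient.mk E.atiyahCocycle : GenCplx.Cech.H1 E.cover E.endForms) = 0 →
      GenCplx.Cech.toH1Lim E.cover E.covers E.endForms
        (Submodule.Quotient.mk E.atiyahCocycle) = 0 := fun h => by
    rw [h, map_zero]
  exact ⟨E.atiyahCocycle, E.isAtiyahCocycle_atiyahCocycle, ⟨hf, fun h => hb (hl h)⟩,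
    ⟨fun h => hl (hf h), hb⟩⟩
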